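/- \textbf{True system.} Let $z(k+1)=\bar\theta^{(1)T}\varphi_z^{(1)}(k)+v(k)$, $y(k)=z(k)+d(k)$, $k\in\mathbb Z$, be a SISO ARX system of order $n\ge1$, where $\varphi_z^{(p)}(k)=[z(k),\dots,z(k-n+1),u(k-1),\dots,u(k-n+1),u(k),\dots,u(k+p-1)]^T$. It is asymptotically stable with non-zero static gain, $|d(k)|\le\bar d$, $|v(k)|\le\bar v$ with $\bar d,\bar v>0$, and the input set $\mathbb U\subset\mathbb R$ is compact and convex. The output constraint set $\mathbb Z\subseteq\mathbb R$ is convex. A trajectory is a quadruple $(z,u,v,d)$ of signals on $\mathbb Z$ that satisfies the system equation, these bounds and $u(k)\in\mathbb U$ for all $k$, with $z$ bounded as $k\to-\infty$. \textbf{Learning.} Let $o\ge n$, $\bar p\ge1$, and $\varphi_y^{(p)}(k)=[y(k),\dots,y(k-o+1),u(k-1),\dots,u(k-o+1),u(k),\dots,u(k+p-1)]^T$. Let $\Phi^{(p)}$ be the set of all $\varphi^{(p)}_y(k)$, and $\mathcal T_p$ the set of all pairs $(\varphi_y^{(p)}(k),y(k+p))$, over all trajectories and all $k$. For each $p\in[1,\bar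 p]$ let $\Omega^{(p)}$ be a compact parameter set, let finitely many (at least one) data $(\tilde\varphi_i,\tilde y_i)\in\mathcal T_p$ be given, and put - $\bar\epsilon_p^*=\min_{\theta\in\Omega^{(p)}}\min\{\epsilon:|y-\theta^T\varphi|\le\epsilon+\bar d\ \ \forall(\varphi,y)\in\mathcal T_p\}$; - $\underline\lambda_p=\min\{\lambda\ge0:\exists\theta\in\Omega^{(p)}\ \forall i\ |\tilde y_i-\theta^T\tilde\varphi_i|\le\lambda+\bar d\}$, and $\hat{\bar\epsilon}_p=\alpha_p\underline\lambda_p$ with $\alpha_p>1$, where it is assumed that $\hat{\bar\epsilon}_p\ge\bar\epsilon_p^*$; - $\Theta^{(p)}=\{\theta\in\Omega^{(p)}:|\tilde y_i-\theta^T\tilde\varphi_i|\le\hat{\bar\epsilon}_p+\bar d\ \forall i\}$; - $\tau_p(\hat\theta)=\max_{\varphi\in\Phi^{(p)}}\max_{\theta\in\Theta^{(p)}}|(\theta-\hat\theta)^T\varphi|+\hat{\bar\epsilon}_p$, and $\hat\tau_p(\hat\theta)=\gamma_p\big(\max_i\max_{\theta\in\Theta^{(p)}}|(\theta-\hat\theta)^T\tilde\varphi_i|+\hat{\bar\epsilon}_p\big)$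 with $\gamma_p>1$. Let $\hat\theta^{(p)*}=[\hat\theta_{AR}^{(p)*T}\ \hat\theta_U^{(p)*T}\ \hat\theta_{\bar U}^{(p)*T}]^T$ (blocks of length $o$, $o-1$, $p$) minimize $\hat\tau_p$ over $\Theta^{(p)}$. Let $A,B_1,M_1,C$ be the realization of the one-step model $\hat\theta^{(1)*}$ with state $X(k)=[z(k),\dots,z(k-o+1),u(k-1),\dots,u(k-o+1)]^T$, so that $X(k+1)=AX(k)+B_1u(k)+M_1w(k)$, $z(k)=CX(k)$, with $M_1=[1,0,\dots,0]^T$ and $C=[1,0,\dots,0]$. Let $\hat\theta^{(p),1}$ be the parameter of the $p$-step predictor $CA^pX_y(k)+C\sum_{i<p}A^iB_1u(k+p-i-1)$ obtained by iterating this model, where $X_y$ is $X$ with $y$ in place of $z$. Assume $\hat\tau_p(\hat\theta^{(p),1})\ge\tau_p(\hat\theta^{(p),1})$ for $p\in[1,\bar p]$. Let $\bar w$ be the least $w\ge0$ with $\sum_{i=0}^{p-1}|CA^iM_1|\,w+\|CA^pE\|_\infty\bar d\ge\hat\tau_p(\hat\theta^{(p),1})$ for all $p\in[1,\bar p]$,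 where $E=[I_o\ 0]^T$ and $\|\cdot\|_\infty$ is the induced norm (for a row vector, the sum of the absolute values of its entries). \textbf{Controller.} Let $C_p=[\hat\theta_{AR}^{(p)*T}\ \hat\theta_U^{(p)*T}]$ and $D_p=[\hat\theta_{\bar U}^{(p)*T}\ 0_{1,\bar p+1-p}]$ for $p\ge1$, and $C_0=C$, $D_0=0$. Let $\hat\mu\ne0$ be a gain estimate, $N=[\mathbf 1_o^T\ \ \hat\mu^{-1}\mathbf 1_{o-1}^T]^T$, $\eta_{zw}=M_1^T[(I-A)N-B_1\hat\mu^{-1}]$, and let $K,L$ be such that $A+B_1K$ and $A-LC$ are Schur stable. For a reference $z_{\rm ref}$ put $u_{\rm ref}=\hat\mu^{-1}z_{\rm ref}$, $X_{\rm ref}=Nz_{\rm ref}$, $\hat w=\eta_{zw}z_{\rm ref}$, $z_{\rm ref}^p=C_pX_{\rm ref}+D_p\mathbf 1u_{\rm ref}$. The nominal system is $\bar X(k+1)=A\bar X(k)+B_1\bar u(k)+M_1\hat w$, with $\hat w$ constant over the horizon. With $\bar U(k)=[\bar u(k),\dots,\bar u(k+\bar p)]^T$, the cost is $$J(k)=\sum_{p=0}^{\bar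 p}\Big(Q_p(C_p\bar X(k)+D_p\bar U(k)-z^p_{\rm ref})^2+R_p(\bar u(k+p)-u_{\rm ref})^2\Big)+\|\bar X(k+\bar p+1)-X_{\rm ref}\|_P^2+\sigma(z_{\rm ref}-z_{\rm goal})^2 .$$ The weights satisfy $(A+B_1K)^TP(A+B_1K)-P=-T_N-K^TR_{\bar p}K$, $\Psi^T\mathcal Q\Psi\le\bar\Psi^T\bar{\mathcal Q}\bar\Psi$ and $T_N,\mathcal R,\mathcal Q,P>0$, where $\mathcal Q={\rm diag}(Q_0,\dots,Q_{\bar p})$, $\mathcal R={\rm diag}(R_0/2,R_1-R_0,\dots,R_{\bar p}-R_{\bar p-1})$, $\bar{\mathcal Q}={\rm diag}(Q_1,\dots,Q_{\bar p},T_N,\mathcal R)$; $\Psi$ has the rows $[C_pA,\ C_pB+D_pH_1]$, $p=0,\dots,\bar p$, with $B=[B_1\ 0]$ and $H_1$ the upper shift matrix of size $\bar p+1$; and $\bar\Psi$ has the block rows $[C_p,D_p]$ ($p=1,\dots,\bar p$), $[A^{\bar p+1},\Gamma]$ with $\Gamma=[A^{\bar p}B_1\cdots B_1]$, and $[0,I_{\bar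 p+1}]$. The set $\hat{\mathbb E}$ is robustly positively invariant for $e^+=(A-LC)e+M_1\delta-Ld$ with $|\delta|\le2\bar w$, $|d|\le\bar d$, and $\bar{\mathbb E}$ is robustly positively invariant for $e^+=(A+B_1K)e+LC\hat e+Ld$ with $\hat e\in\hat{\mathbb E}$, $|d|\le\bar d$. The sets $\bar{\mathbb U}\subseteq\mathbb U\ominus K\bar{\mathbb E}$ and $\bar{\mathbb Z}\subseteq\mathbb Z\ominus C(\bar{\mathbb E}\oplus\hat{\mathbb E})$ are closed, $\mathbb W=[-\bar w,\bar w]$, $\bar{\mathbb X}=\bar{\mathbb Z}\times\bar{\mathbb U}\times\mathbb W$, and for some $\varepsilon>0$ the compact set $\bar{\mathbb X}(\varepsilon)$ satisfies $\bar{\mathbb X}(\varepsilon)\oplus\mathcal B_\varepsilon^3(0)\subseteq\bar{\mathbb X}$ ($\mathcal B^3_\varepsilon(0)$ the closed Euclidean ball). The terminal set $\mathbb O_\varepsilon$ consists of the $(\bar X,z_{\rm ref})$ for which, under the nominal dynamics with $\bar u=u_{\rm ref}+K(\bar X-X_{\rm ref})$ and constant $z_{\rm ref}$, the output $(C\bar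 X,\bar u,\hat w)$ lies in $\bar{\mathbb X}$ at all times and converges to a point of $\bar{\mathbb X}(\varepsilon)$. At each $k\ge0$, the problem is to minimize $J(k)$ over $\bar X(k),\bar U(k),z_{\rm ref}(k)$ subject to $\hat X(k)-\bar X(k)\in\bar{\mathbb E}$; $\bar u(k+p)\in\bar{\mathbb U}$ and $C\bar X(k+p)\in\bar{\mathbb Z}$ for $p\in[0,\bar p]$; $\hat w\in\mathbb W$; and $(\bar X(k+\bar p+1),z_{\rm ref}(k))\in\mathbb O_\varepsilon$. Let $\bar X(k|k)$, $\bar u(k|k)$, $z_{\rm ref}(k|k)$ be the nominal state, first input and reference of a solution. The input $u(k)=\bar u(k|k)+K(\hat X(k)-\bar X(k|k))$ is applied to the true system, and the observer is $\hat X(k+1)=A\hat X(k)+B_1u(k)+M_1\hat w(k)+L(y(k)-C\hat X(k))$ with $\hat w(k)=\eta_{zw}z_{\rm ref}(k|k)$ and $X(0)-\hat X(0)\in\hat{\mathbb E}$. Before time $0$, $u(k)\in\mathbb U$ and $z$ is bounded. \textbf{Theorem.} (1) For every $\sigma>0$ and $z_{\rm goal}\in\mathbb R$: if the problem is feasible at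 $k=0$, then it is feasible at all $k>0$, and $u(k)\in\mathbb U$, $z(k)\in\mathbb Z$ for all $k\ge0$. (2) Suppose moreover that $\bar{\mathbb E},\bar{\mathbb U},\bar{\mathbb Z},\bar{\mathbb X}(\varepsilon)$ are convex. There is $\sigma_0$, depending neither on $z_{\rm goal}$ nor on the run of the closed loop, such that for every $\sigma>\sigma_0$ and every $z_{\rm goal}$: if the problem is feasible at $k=0$, then there is exactly one point $z^{\rm FEASIBLE}_{\rm goal}$ that minimizes $|\tilde z-z_{\rm goal}|$ over all $\tilde z$ with $(\tilde z,\hat\mu^{-1}\tilde z,\eta_{zw}\tilde z)\in\bar{\mathbb X}(\varepsilon)$, and, as $k\to\infty$, $C\bar X(k|k)\to z_{\rm goal}^{\rm FEASIBLE}$ and ${\rm dist}\big(z(k),\ z_{\rm goal}^{\rm FEASIBLE}\oplus C(\bar{\mathbb E}\oplus\hat{\mathbb E})\big)\to0$. -/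

import Mathlib

open Matrix Filter Topology

noncomputable section

namespace LearnedMPC

/-! ### Regressors -/

/-- Index set of the state `[z(k), …, z(k-m+1), u(k-1), …, u(k-m+1)]` of an ARX model of order `m`
(dimension `2m-1`). -/
abbrev SIdx (m : ℕ) : Type := Fin m ⊕ Fin (m - 1)

/-- State vectors of an ARX model of order `m`. -/
abbrev State (m : ℕ) : Type := SIdx m → ℝ

/-- Regressors, and parameter vectors, of a `p`-step-ahead model of order `m`
(dimension `2m-1+p`). A parameter vector `θ` splits into `θ_AR` (indices `inl (inl _)`),
`θ_U` (indices `inl (inr _)`) and `θ_Ū` (indices `inr _`). -/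
abbrev Reg (m p : ℕ) : Type := SIdx m ⊕ Fin p → ℝ

/-- `[s(k), …, s(k-m+1), u(k-1), …, u(k-m+1)]`. -/
def stateOf (m : ℕ) (s u : ℤ → ℝ) (k : ℤ) : State m :=
  Sum.elim (fun i : Fin m => s (k - (i : ℕ))) (fun j : Fin (m - 1) => u (k - 1 - (j : ℕ)))

/-- `[s(k), …, s(k-m+1), u(k-1), …, u(k-m+1), u(k), …, u(k+p-1)]`. -/
def regressor (m p : ℕ) (s u : ℤ → ℝ) (k : ℤ) : Reg m p :=
  Sum.elim (stateOf m s u k) (fun j : Fin p => u (k + (j : ℕ)))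

/-! ### State-space realization of a one-step-ahead model -/

section Realization

variable {m : ℕ}

/-- The matrix `A`: its first row is `[θ_AR θ_U]`, the other rows shift the past outputs and the
past inputs. -/
def matA (θ : Reg m 1) : Matrix (SIdx m) (SIdx m) ℝ := Matrix.of fun row col =>
  match row, col with
  | .inl i, c =>
      if (i : ℕ) = 0 then θ (.inl c)
      else match c with
        | .inl i' => if (i' : ℕ) + 1 = i then 1 else 0
        | .inr _ => 0
  | .inr _, .inl _ => 0
  | .inr j, .inr j' => if (j' : ℕ) + 1 = j then 1 else 0

/-- The input vector `B₁`. -/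
def vecB (θ : Reg m 1) : State m :=
  Sum.elim (fun i => if (i : ℕ) = 0 then θ (.inr 0) else 0)
    (fun j => if (j : ℕ) = 0 then 1 else 0)

/-- The disturbance vector `M₁`. -/
def vecM (m : ℕ) : State m := Sum.elim (fun i => if (i : ℕ) = 0 then 1 else 0) (fun _ => 0)

/-- The output vector `C`. -/
def vecC (m : ℕ) : State m := Sum.elim (fun i => if (i : ℕ) = 0 then 1 else 0) (fun _ => 0)

/-- The parameter vector `θ̂^{(p),1}` of the `p`-step-ahead predictor obtained by iterating the
one-step-ahead model `θ`, i.e. of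
`C A^p X_y(k) + C ∑_{i<p} A^i B₁ u(k+p-i-1)`. -/
def iterated (θ : Reg m 1) (p : ℕ) : Reg m p :=
  Sum.elim (vecC m ᵥ* matA θ ^ p)
    (fun j : Fin p => vecC m ⬝ᵥ (matA θ ^ (p - 1 - (j : ℕ)) *ᵥ vecB θ))

end Realization

/-- Schur stability: all complex eigenvalues lie in the open unit disc. -/
def IsSchur {ι : Type} [Fintype ι] [DecidableEq ι] (M : Matrix ι ι ℝ) : Prop :=
  ∀ l ∈ spectrum ℂ (M.map Complex.ofReal), ‖l‖ < 1

/-! ### The true system -/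

/-- The true system `z(k+1) = θᵀ φ_z(k) + v(k)`, `y(k) = z(k) + d(k)`, of order `n`, with its input
set and the bounds on its measurement noise and its disturbance. -/
structure Plant where
  n : ℕ
  θ : Reg n 1
  U : Set ℝ
  dbar : ℝ
  vbar : ℝ

namespace Plant

variable (S : Plant)

/-- The static gain from `u` to `z`. -/
def gain : ℝ :=
  ((∑ j, S.θ (.inl (.inr j))) + S.θ (.inr 0)) / (1 - ∑ i, S.θ (.inl (.inl i)))

/-- Standing assumptions on the system and its signals. -/
structure Standing : Prop where
  order_pos : 1 ≤ S.n
  stable : IsSchur (matA S.θ)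
  gain_ne : S.gain ≠ 0
  U_compact : IsCompact S.U
  U_convex : Convex ℝ S.U
  dbar_pos : 0 < S.dbar
  vbar_pos : 0 < S.vbar

/-- The system equation. -/
def IsARX (z u v : ℤ → ℝ) : Prop :=
  ∀ k, z (k + 1) = S.θ ⬝ᵥ regressor S.n 1 z u k + v k

/-- The trajectories of the system that meet the standing assumptions on the signals. Boundedness of
`z` in the past discards the spurious solutions that blow up as `k → -∞`; since the system is
asymptotically stable, it is the same as boundedness of `z` on all of `ℤ`. -/
structure IsTrajectory (z u v d : ℤ → ℝ) : Prop where
  arx : S.IsARX z u v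
  input : ∀ k, u k ∈ S.U
  noise : ∀ k, |d k| ≤ S.dbar
  disturbance : ∀ k, |v k| ≤ S.vbar
  past_bounded : ∃ b, ∀ k ≤ 0, |z k| ≤ b

/-- `Φ^{(p)}`: all noise-corrupted regressors `φ_y^{(p)}(k)` of the system. -/
def regressorSet (o p : ℕ) : Set (Reg o p) :=
  {φ | ∃ z u v d, S.IsTrajectory z u v d ∧ ∃ k, φ = regressor o p (z + d) u k}

/-- `𝒯_p`: all pairs of a noise-corrupted regressor and a compatible `p`-step-ahead output
measurement. -/
def pairSet (o p : ℕ) : Set (Reg o p × ℝ) :=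
  {x | ∃ z u v d, S.IsTrajectory z u v d ∧
    ∃ k, x = (regressor o p (z + d) u k, z (k + p) + d (k + p))}

/-- `ε̄_p(θ)`, the least `ε` with `|y - θᵀφ| ≤ ε + d̄` on `𝒯_p` (`⊤` if there is none). -/
def errorBound (o p : ℕ) (θ : Reg o p) : EReal :=
  ⨅ (e : ℝ) (_ : ∀ x ∈ S.pairSet o p, |x.2 - θ ⬝ᵥ x.1| ≤ e + S.dbar), (e : EReal)

end Plant

/-! ### Set-membership learning -/

/-- The ingredients of the learning phase for models of order `o`: for every `p`, the `N p` measured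
pairs, the parameter set `Ω^{(p)}`, and the inflation factors `α` and `γ`. -/
structure Learning (o : ℕ) where
  N : ℕ → ℕ
  data : ∀ p, Fin (N p) → Reg o p × ℝ
  Ω : ∀ p, Set (Reg o p)
  α : ℕ → ℝ
  γ : ℕ → ℝ

namespace Learning

variable {o : ℕ} (D : Learning o) (S : Plant)

/-- The optimal error bound `ε̄_p^*`. -/
def optimalBound (p : ℕ) : EReal := ⨅ θ ∈ D.Ω p, S.errorBound o p θ

/-- `λ_p`, the estimate of the optimal error bound from the data. -/
def lam (p : ℕ) : ℝ :=
  sInf {l | 0 ≤ l ∧ ∃ θ ∈ D.Ω p, ∀ i, |(D.data p i).2 - θ ⬝ᵥ (D.data p i).1| ≤ l + S.dbar}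

/-- The inflated estimate `α λ_p`. -/
def epsHat (p : ℕ) : ℝ := D.α p * D.lam S p

/-- The feasible parameter set `Θ^{(p)}`. -/
def fps (p : ℕ) : Set (Reg o p) :=
  {θ | θ ∈ D.Ω p ∧ ∀ i, |(D.data p i).2 - θ ⬝ᵥ (D.data p i).1| ≤ D.epsHat S p + S.dbar}

/-- The worst-case prediction error bound `τ_p(θ)`. -/
def tau (p : ℕ) (θ : Reg o p) : EReal :=
  (⨆ φ ∈ S.regressorSet o p, ⨆ θ' ∈ D.fps S p, ((|(θ' - θ) ⬝ᵥ φ| : ℝ) : EReal))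
    + ((D.epsHat S p : ℝ) : EReal)

/-- The approximation of `τ_p(θ)` from the data. -/
def tauLow (p : ℕ) (θ : Reg o p) : ℝ :=
  sSup {t | ∃ i, ∃ θ' ∈ D.fps S p, t = |(θ' - θ) ⬝ᵥ (D.data p i).1|} + D.epsHat S p

/-- The inflated approximation `γ τ_p(θ)`. -/
def tauHat (p : ℕ) (θ : Reg o p) : ℝ := D.γ p * D.tauLow S p θ

/-- Standing assumptions of the learning phase, for the horizon `pbar`. -/
structure Standing (pbar : ℕ) : Prop where
  nonempty_data : ∀ p ∈ Finset.Icc 1 pbar, 0 < D.N p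
  data_mem : ∀ p ∈ Finset.Icc 1 pbar, ∀ i, D.data p i ∈ S.pairSet o p
  Ω_compact : ∀ p ∈ Finset.Icc 1 pbar, IsCompact (D.Ω p)
  α_gt : ∀ p ∈ Finset.Icc 1 pbar, 1 < D.α p
  γ_gt : ∀ p ∈ Finset.Icc 1 pbar, 1 < D.γ p
  bound_le : ∀ p ∈ Finset.Icc 1 pbar, D.optimalBound S p ≤ ((D.epsHat S p : ℝ) : EReal)

/-- `θ` consists of nominal multi-step models: `θ p` minimizes the error bound over `Θ^{(p)}`. -/
def IsNominal (pbar : ℕ) (θ : ∀ p, Reg o p) : Prop :=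
  ∀ p ∈ Finset.Icc 1 pbar, θ p ∈ D.fps S p ∧
    ∀ θ' ∈ D.fps S p, D.tauHat S p (θ p) ≤ D.tauHat S p θ'

/-- `γ` is such that the error bounds of the iterated one-step-ahead model are not
underestimated. -/
def BoundsValid (pbar : ℕ) (θ : Reg o 1) : Prop :=
  ∀ p ∈ Finset.Icc 1 pbar,
    D.tau S p (iterated θ p) ≤ ((D.tauHat S p (iterated θ p) : ℝ) : EReal)

/-- The values `w ≥ 0` for which the error bounds of the state-space model dominate those of the
iterated predictors: `∑_{i<p} |C A^i M₁| w + ‖C A^p E‖_∞ d̄ ≥ τ̂_p(θ̂^{(p),1})`, `p = 1, …, pbar`. The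
row vector `C A^p E` consists of the first `o` entries of `C A^p`, and its induced `∞`-norm is the
sum of their absolute values. -/
def disturbanceBounds (pbar : ℕ) (θ : Reg o 1) : Set ℝ :=
  {w | 0 ≤ w ∧ ∀ p ∈ Finset.Icc 1 pbar,
    D.tauHat S p (iterated θ p) ≤
      (∑ i ∈ Finset.range p, |vecC o ⬝ᵥ (matA θ ^ i *ᵥ vecM o)|) * w
        + (∑ i : Fin o, |(vecC o ᵥ* matA θ ^ p) (.inl i)|) * S.dbar}

end Learning

/-! ### The controller -/

/-- The set difference `S ⊖ T`. -/
def pdiff (S T : Set ℝ) : Set ℝ := {x | ∀ t ∈ T, x + t ∈ S}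

/-- The data of the controller for models of order `o` and horizon `pbar`: learned models, bound on
the disturbance, gain estimate, gains, weights, invariant sets, tightened constraint sets, and the
set `X_ZUW(ε)`. -/
structure Controller (o pbar : ℕ) where
  θ : ∀ p, Reg o p
  wbar : ℝ
  μ : ℝ
  K : State o
  L : State o
  Q : ℕ → ℝ
  R : ℕ → ℝ
  P : Matrix (SIdx o) (SIdx o) ℝ
  TN : Matrix (SIdx o) (SIdx o) ℝ
  Ehat : Set (State o)
  Ebar : Set (State o)
  Ubar : Set ℝ
  Zbar : Set ℝ
  ε : ℝ
  Xε : Set (ℝ × ℝ × ℝ)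

/-- Decision variables: nominal state `X̄(k)`, nominal inputs `ū(k), …, ū(k+pbar)`, reference. -/
structure Decision (o pbar : ℕ) where
  X : State o
  U : Fin (pbar + 1) → ℝ
  zref : ℝ

namespace Controller

variable {o pbar : ℕ} (c : Controller o pbar)

def A : Matrix (SIdx o) (SIdx o) ℝ := matA (c.θ 1)

def B₁ : State o := vecB (c.θ 1)

/-- `A + B₁ K`. -/
def AK : Matrix (SIdx o) (SIdx o) ℝ := c.A + vecMulVec c.B₁ c.K

/-- `A - L C`. -/
def AL : Matrix (SIdx o) (SIdx o) ℝ := c.A - vecMulVec c.L (vecC o)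

/-- `C_p`. -/
def Cp (p : ℕ) : State o := if p = 0 then vecC o else fun i => c.θ p (.inl i)

/-- `D_p` (which is zero for `p = 0`). -/
def Dp (p : ℕ) : Fin (pbar + 1) → ℝ :=
  fun j => if h : (j : ℕ) < p then c.θ p (.inr ⟨j, h⟩) else 0

/-- `N`, the steady state for unit output reference. -/
def Nvec : State o := Sum.elim (fun _ => 1) (fun _ => c.μ⁻¹)

/-- `η_zw = M₁ᵀ ((I - A) N - B₁ μ⁻¹)`. -/
def η : ℝ := vecM o ⬝ᵥ ((1 - c.A) *ᵥ c.Nvec - c.μ⁻¹ • c.B₁)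

/-- `M₂ = μ⁻¹ - K N`. -/
def M₂ : ℝ := c.μ⁻¹ - c.K ⬝ᵥ c.Nvec

/-- The set `W` of admissible disturbance estimates. -/
def W : Set ℝ := {w | |w| ≤ c.wbar}

/-! #### Weights -/

/-- `B = [B₁ 0]`. -/
def B : Matrix (SIdx o) (Fin (pbar + 1)) ℝ :=
  Matrix.of fun x j => if (j : ℕ) = 0 then c.B₁ x else 0

/-- The upper shift `H₁`. -/
def H₁ (pbar : ℕ) : Matrix (Fin (pbar + 1)) (Fin (pbar + 1)) ℝ :=
  Matrix.of fun i j => if (j : ℕ) = i + 1 then 1 else 0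

/-- `Γ = [A^pbar B₁ … B₁]`. -/
def Γ : Matrix (SIdx o) (Fin (pbar + 1)) ℝ :=
  Matrix.of fun x j => (c.A ^ (pbar - (j : ℕ)) *ᵥ c.B₁) x

/-- `Ψ`, with rows `[C_p A, C_p B + D_p H₁]`, `p = 0, …, pbar`. -/
def Psi : Matrix (Fin (pbar + 1)) (SIdx o ⊕ Fin (pbar + 1)) ℝ :=
  Matrix.of fun p => Sum.elim (c.Cp p ᵥ* c.A) (c.Cp p ᵥ* c.B + c.Dp p ᵥ* H₁ pbar)

/-- `Ψ̄`, with rows `[C_p, D_p]` (`p = 1, …, pbar`), `[A^(pbar+1), Γ]`, `[0, I]`. -/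
def PsiBar : Matrix (Fin pbar ⊕ (SIdx o ⊕ Fin (pbar + 1))) (SIdx o ⊕ Fin (pbar + 1)) ℝ :=
  Matrix.fromRows
    (Matrix.of fun p : Fin pbar => Sum.elim (c.Cp ((p : ℕ) + 1)) (c.Dp ((p : ℕ) + 1)))
    (Matrix.fromRows (Matrix.fromCols (c.A ^ (pbar + 1)) c.Γ) (Matrix.fromCols 0 1))

/-- `diag(Q₀, …, Q_pbar)`. -/
def calQ : Matrix (Fin (pbar + 1)) (Fin (pbar + 1)) ℝ := Matrix.diagonal fun p => c.Q p

/-- `diag(R₀/2, R₁ - R₀, …, R_pbar - R_(pbar-1))`. -/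
def calR : Matrix (Fin (pbar + 1)) (Fin (pbar + 1)) ℝ :=
  Matrix.diagonal fun p => if (p : ℕ) = 0 then c.R 0 / 2 else c.R p - c.R ((p : ℕ) - 1)

/-- `diag(Q₁, …, Q_pbar, T_N, calR)`. -/
def calQbar : Matrix (Fin pbar ⊕ (SIdx o ⊕ Fin (pbar + 1)))
    (Fin pbar ⊕ (SIdx o ⊕ Fin (pbar + 1))) ℝ :=
  Matrix.fromBlocks (Matrix.diagonal fun p : Fin pbar => c.Q ((p : ℕ) + 1)) 0 0
    (Matrix.fromBlocks c.TN 0 0 c.calR)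

/-- The matrix conditions on the weights. -/
structure WeightsValid : Prop where
  lyapunov : c.AKᵀ * c.P * c.AK - c.P = -c.TN - c.R pbar • vecMulVec c.K c.K
  ineq : (c.PsiBarᵀ * c.calQbar * c.PsiBar - c.Psiᵀ * c.calQ * c.Psi).PosSemidef
  TN_pos : c.TN.PosDef
  R_pos : c.calR.PosDef
  Q_pos : c.calQ.PosDef
  P_pos : c.P.PosDef

/-! #### Tightened constraints and terminal set -/

/-- `X_ZUW`, the product of the tightened constraint sets for `(z̄, ū, ŵ)`. -/
def Xzuw : Set (ℝ × ℝ × ℝ) := c.Zbar ×ˢ c.Ubar ×ˢ c.W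

/-- One step of the nominal system under the auxiliary law, with constant reference (the map
`calF`). -/
def auxStep (x : State o × ℝ) : State o × ℝ :=
  (c.AK *ᵥ x.1 + (c.M₂ * x.2) • c.B₁ + (c.η * x.2) • vecM o, x.2)

/-- The output `(z̄, ū, ŵ)` of the auxiliary system (the map `calC`). -/
def auxOut (x : State o × ℝ) : ℝ × ℝ × ℝ :=
  (vecC o ⬝ᵥ x.1, c.K ⬝ᵥ x.1 + c.M₂ * x.2, c.η * x.2)

/-- The terminal set `O_ε`. -/
def terminalSet : Set (State o × ℝ) :=
  {x | (∀ k : ℕ, c.auxOut (c.auxStep^[k] x) ∈ c.Xzuw) ∧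
    ∃ y ∈ c.Xε, Tendsto (fun k : ℕ => c.auxOut (c.auxStep^[k] x)) atTop (𝓝 y)}

/-- Requirements on the gains, weights and sets of the controller, for the system `S` and the
output constraint set `Z`. -/
structure WellDesigned (S : Plant) (Z : Set ℝ) : Prop where
  gain_ne : c.μ ≠ 0
  K_schur : IsSchur c.AK
  L_schur : IsSchur c.AL
  weights : c.WeightsValid
  /-- `Ê` is robustly positively invariant for the estimation error. -/
  Ehat_rpi : ∀ e ∈ c.Ehat, ∀ w d : ℝ, |w| ≤ 2 * c.wbar → |d| ≤ S.dbar →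
    c.AL *ᵥ e + w • vecM o - d • c.L ∈ c.Ehat
  /-- `Ē` is robustly positively invariant for the deviation of the estimate from the nominal
  state. -/
  Ebar_rpi : ∀ e ∈ c.Ebar, ∀ e' ∈ c.Ehat, ∀ d : ℝ, |d| ≤ S.dbar →
    c.AK *ᵥ e + (vecC o ⬝ᵥ e') • c.L + d • c.L ∈ c.Ebar
  Ubar_closed : IsClosed c.Ubar
  Zbar_closed : IsClosed c.Zbar
  Ubar_sub : c.Ubar ⊆ pdiff S.U ((fun e => c.K ⬝ᵥ e) '' c.Ebar)
  Zbar_sub : c.Zbar ⊆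
    pdiff Z ((fun e : State o × State o => vecC o ⬝ᵥ (e.1 + e.2)) '' (c.Ebar ×ˢ c.Ehat))
  ε_pos : 0 < c.ε
  Xε_compact : IsCompact c.Xε
  /-- The Euclidean `ε`-neighbourhood of `X_ZUW(ε)` lies in `X_ZUW`. -/
  Xε_sub : ∀ x ∈ c.Xε, ∀ a b w : ℝ, a ^ 2 + b ^ 2 + w ^ 2 ≤ c.ε ^ 2 →
    (x.1 + a, x.2.1 + b, x.2.2 + w) ∈ c.Xzuw

/-- Convexity of the sets that enter the optimization problem. -/
structure ConvexSets : Prop where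
  Ebar : Convex ℝ c.Ebar
  Ubar : Convex ℝ c.Ubar
  Zbar : Convex ℝ c.Zbar
  Xε : Convex ℝ c.Xε

/-! #### The optimization problem -/

/-- Nominal prediction `X̄(k+j)`, `j ≤ pbar + 1`, from the decision `s`, under
`X̄⁺ = A X̄ + B₁ ū + M₁ ŵ` with `ŵ = η zref` constant over the horizon. -/
def predict (s : Decision o pbar) : ℕ → State o
  | 0 => s.X
  | j + 1 => c.A *ᵥ predict s j + (if h : j < pbar + 1 then s.U ⟨j, h⟩ else 0) • c.B₁
      + (c.η * s.zref) • vecM o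

/-- The reference `z_ref^p` of the `p`-step-ahead model. -/
def refOut (p : ℕ) (r : ℝ) : ℝ :=
  c.Cp p ⬝ᵥ (r • c.Nvec) + c.Dp p ⬝ᵥ (fun _ => c.μ⁻¹ * r)

/-- The cost function. -/
def cost (σ zgoal : ℝ) (s : Decision o pbar) : ℝ :=
  ∑ p : Fin (pbar + 1),
      (c.Q p * (c.Cp p ⬝ᵥ s.X + c.Dp p ⬝ᵥ s.U - c.refOut p s.zref) ^ 2
        + c.R p * (s.U p - c.μ⁻¹ * s.zref) ^ 2)
    + (c.predict s (pbar + 1) - s.zref • c.Nvec) ⬝ᵥ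
        (c.P *ᵥ (c.predict s (pbar + 1) - s.zref • c.Nvec))
    + σ * (s.zref - zgoal) ^ 2

/-- The constraints of the optimization problem, for the state estimate `Xh`. -/
structure Admissible (Xh : State o) (s : Decision o pbar) : Prop where
  initial : Xh - s.X ∈ c.Ebar
  input : ∀ p : Fin (pbar + 1), s.U p ∈ c.Ubar
  output : ∀ p : Fin (pbar + 1), vecC o ⬝ᵥ c.predict s p ∈ c.Zbar
  estimate : c.η * s.zref ∈ c.W
  terminal : (c.predict s (pbar + 1), s.zref) ∈ c.terminalSet

/-- Feasibility of the optimization problem for the state estimate `Xh`. -/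
def Feasible (Xh : State o) : Prop := ∃ s, c.Admissible Xh s

/-- `s` solves the optimization problem for the state estimate `Xh`. -/
def IsOptimal (σ zgoal : ℝ) (Xh : State o) (s : Decision o pbar) : Prop :=
  c.Admissible Xh s ∧ ∀ s', c.Admissible Xh s' → c.cost σ zgoal s ≤ c.cost σ zgoal s'

/-- Admissible set-points: `(z̃, μ⁻¹ z̃, η z̃) ∈ X_ZUW(ε)`. -/
def setPoints : Set ℝ :=
  {z | (vecC o ⬝ᵥ (z • c.Nvec), c.μ⁻¹ * z, c.η * z) ∈ c.Xε}

/-- `x` is an admissible set-point closest to `zgoal`. -/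
def IsClosest (zgoal x : ℝ) : Prop :=
  x ∈ c.setPoints ∧ ∀ y ∈ c.setPoints, |x - zgoal| ≤ |y - zgoal|

end Controller

/-! ### The closed loop -/

/-- The signals of the closed loop. The true system lives on `ℤ`, the controller acts from time `0`
on. -/
structure Signals (o pbar : ℕ) where
  z : ℤ → ℝ
  u : ℤ → ℝ
  v : ℤ → ℝ
  d : ℤ → ℝ
  Xhat : ℕ → State o
  sol : ℕ → Decision o pbar

/-- `r` is a run of the closed loop of the true system `S`, the observer and the predictive
controller. Whenever the optimization problem is feasible, `r.sol k` is one of its solutions;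
otherwise `r.sol k` is arbitrary. -/
structure IsClosedLoop {o pbar : ℕ} (S : Plant) (c : Controller o pbar) (σ zgoal : ℝ)
    (r : Signals o pbar) : Prop where
  arx : S.IsARX r.z r.u r.v
  noise : ∀ k, |r.d k| ≤ S.dbar
  disturbance : ∀ k, |r.v k| ≤ S.vbar
  past_input : ∀ k < 0, r.u k ∈ S.U
  past_bounded : ∃ b, ∀ k ≤ 0, |r.z k| ≤ b
  /-- The initial estimation error lies in `Ê`. -/
  initial : stateOf o r.z r.u 0 - r.Xhat 0 ∈ c.Ehat
  observer : ∀ k : ℕ, r.Xhat (k + 1) =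
    c.A *ᵥ r.Xhat k + r.u k • c.B₁ + (c.η * (r.sol k).zref) • vecM o
      + (r.z k + r.d k - vecC o ⬝ᵥ r.Xhat k) • c.L
  law : ∀ k : ℕ, r.u k = (r.sol k).U 0 + c.K ⬝ᵥ (r.Xhat k - (r.sol k).X)
  optimal : ∀ k : ℕ, c.Feasible (r.Xhat k) → c.IsOptimal σ zgoal (r.Xhat k) (r.sol k)

end LearnedMPC

end

open LearnedMPC

open Matrix Filter Topology

namespace LearnedMPC

/-! ### The realization of a one-step-ahead model -/

section Realization

variable {m : ℕ}

/-! Feasibility. For `p = 1` the definition of `wbar` bounds the one-step error on noisy data by `w̄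
+ (∑ |θ_AR|) d̄ + d̄`. The noise of a trajectory may be exchanged for any other admissible noise,
and the worst choice of signs consumes exactly `(1 + ∑ |θ_AR|) d̄`; hence the noise-free residual is
at most `w̄` (`abs_residual_le`). Along the closed loop the true state therefore obeys the learned
model with a disturbance bounded by `w̄`, the estimate `ŵ` obeys the same bound, the estimation
error stays in `Ê`, and the deviation from the nominal state lands in `Ē`. The old solution, shifted
by one stage and completed by the auxiliary law, is then admissible (`feasible_and_err_mem`).

Convergence. In deviations from the steady state of the reference, the cost is a quadratic form,
`trackingCost`, plus the offset term. The matrix inequality on the weights and the Lyapunov equation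
make this form decrease along the shifted candidate (`trackingCost_shift_le`). So the optimal costs
converge and the first input deviation vanishes. Comparing the next optimum with its average with
the candidate shows that the two differ by a vanishing tracking cost
(`IsOptimal.trackingCost_sub_le`): the optima asymptotically follow their own shifts. It follows
that all input deviations, the terminal deviations and all outputs `C_p A^j x` vanish
(`tendsto_of_asymptotic_shift`); convergence of the full state deviation is not needed.

Once the deviations are small, the margin `ε` allows the reference to be moved by a fixed fraction
`β` of its distance to the closest set-point (`Admissible.move_ref`). Optimality against this move
bounds the squared distance by a multiple of the tracking cost, which tends to zero
(`IsOptimal.sq_sub_le`). Since `β` may depend on `σ`, every `σ > 0` is large enough. -/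

lemma sumElim_dotProduct_sumElim {ι κ : Type*} [Fintype ι] [Fintype κ] (a c : ι → ℝ) (b d : κ → ℝ) :
    Sum.elim a b ⬝ᵥ Sum.elim c d = a ⬝ᵥ c + b ⬝ᵥ d := by
  simp [dotProduct, Fintype.sum_sum_type]

lemma vecC_dotProduct (hm : 0 < m) (x : State m) : vecC m ⬝ᵥ x = x (.inl ⟨0, hm⟩) := by
  simp only [dotProduct, vecC, Fintype.sum_sum_type, Sum.elim_inl, Sum.elim_inr, ite_mul, one_mul,
    zero_mul, Finset.sum_const_zero, add_zero]
  rw [Finset.sum_eq_single ⟨0, hm⟩]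
  · simp
  · intro b _ hb
    rw [if_neg]
    exact fun h => hb (Fin.ext h)
  · simp

lemma matA_mulVec_inl_zero (θ : Reg m 1) (x : State m) (i : Fin m) (hi : (i : ℕ) = 0) :
    (matA θ *ᵥ x) (.inl i) = (fun c => θ (.inl c)) ⬝ᵥ x := by
  simp [mulVec, matA, hi]

lemma matA_mulVec_inl_succ (θ : Reg m 1) (x : State m) (i : ℕ) (hi : i + 1 < m) :
    (matA θ *ᵥ x) (.inl ⟨i + 1, hi⟩) = x (.inl ⟨i, by omega⟩) := by
  simp only [mulVec, dotProduct, Fintype.sum_sum_type, matA, of_apply]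
  rw [Finset.sum_eq_single ⟨i, by omega⟩]
  · simp
  · intro b _ hb
    have : (b : ℕ) ≠ i := fun h => hb (Fin.ext h)
    simp [this]
  · simp

lemma matA_mulVec_inr_zero (θ : Reg m 1) (x : State m) (j : Fin (m - 1)) (hj : (j : ℕ) = 0) :
    (matA θ *ᵥ x) (.inr j) = 0 := by
  simp [mulVec, matA, dotProduct, Fintype.sum_sum_type, hj]

lemma matA_mulVec_inr_succ (θ : Reg m 1) (x : State m) (j : ℕ) (hj : j + 1 < m - 1) :
    (matA θ *ᵥ x) (.inr ⟨j + 1, hj⟩) = x (.inr ⟨j, by omega⟩) := by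
  simp only [mulVec, dotProduct, Fintype.sum_sum_type, matA, of_apply, zero_mul,
    Finset.sum_const_zero, zero_add]
  rw [Finset.sum_eq_single ⟨j, by omega⟩]
  · simp
  · intro b _ hb
    have : (b : ℕ) ≠ j := fun h => hb (Fin.ext h)
    simp [this]
  · simp

/-- The realization reproduces the shift of the regressor; the disturbance is the residual of the
one-step-ahead model. -/
lemma stateOf_succ (θ : Reg m 1) (s u : ℤ → ℝ) (k : ℤ) :
    stateOf m s u (k + 1) = matA θ *ᵥ stateOf m s u k + u k • vecB θ
      + (s (k + 1) - θ ⬝ᵥ regressor m 1 s u k) • vecM m := by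
  have hθ : θ ⬝ᵥ regressor m 1 s u k
      = (fun c => θ (.inl c)) ⬝ᵥ stateOf m s u k + θ (.inr 0) * u k := by
    simp [dotProduct, regressor, Fintype.sum_sum_type]
  funext x
  rcases x with ⟨i, hi⟩ | ⟨j, hj⟩
  · rcases i with _ | i
    · simp only [Pi.add_apply, Pi.smul_apply, smul_eq_mul]
      rw [matA_mulVec_inl_zero _ _ _ rfl, hθ]
      simp [stateOf, vecB, vecM]
      ring
    · simp only [Pi.add_apply, Pi.smul_apply, smul_eq_mul]
      rw [matA_mulVec_inl_succ]
      simp [stateOf, vecB, vecM]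
  · rcases j with _ | j
    · simp only [Pi.add_apply, Pi.smul_apply, smul_eq_mul]
      rw [matA_mulVec_inr_zero _ _ _ rfl]
      simp [stateOf, vecB, vecM]
    · simp only [Pi.add_apply, Pi.smul_apply, smul_eq_mul]
      rw [matA_mulVec_inr_succ]
      simp [stateOf, vecB, vecM]
      congr 1
      ring

lemma vecC_vecMul_matA (hm : 0 < m) (θ : Reg m 1) :
    vecC m ᵥ* matA θ = fun c => θ (.inl c) := by
  funext c
  have h := vecC_dotProduct hm (fun r => matA θ r c)
  rw [vecMul, h]
  simp [matA]

/-- Lets the bounds imposed on iterated predictors be read, for `p = 1`, as bounds on the model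
itself. -/
lemma iterated_one (hm : 0 < m) (θ : Reg m 1) : iterated θ 1 = θ := by
  funext x
  rcases x with c | j
  · simp [iterated, vecC_vecMul_matA hm]
  · have : j = 0 := Subsingleton.elim _ _
    subst this
    simp [iterated, vecC_dotProduct hm, vecB]

end Realization

/-! ### The disturbance bound of the learned one-step-ahead model -/

namespace Plant

variable {S : Plant}

/-- The noise does not enter the recursion for `z`, so it can be chosen adversarially afterwards. -/
lemma IsTrajectory.congr_noise {z u v d d' : ℤ → ℝ} (h : S.IsTrajectory z u v d)
    (hd' : ∀ k, |d' k| ≤ S.dbar) : S.IsTrajectory z u v d' :=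
  ⟨h.arx, h.input, hd', h.disturbance, h.past_bounded⟩

/-- The output of the system from time `K` on, step by step. -/
noncomputable def continuation (S : Plant) (z u v : ℤ → ℝ) (K : ℤ) : ℕ → ℤ → ℝ
  | 0 => z
  | j + 1 => Function.update (S.continuation z u v K j) (K + j + 1)
      (S.θ ⬝ᵥ regressor S.n 1 (S.continuation z u v K j) u (K + j) + v (K + j))

/-- Stage `j + 1` overwrites only time `K + j + 1`, so values up to time `K + j` are final from
stage `j` on. -/
lemma continuation_of_le (z u v : ℤ → ℝ) (K : ℤ) (j : ℕ) (i : ℤ) (hi : i ≤ K + j) (l : ℕ) :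
    S.continuation z u v K (j + l) i = S.continuation z u v K j i := by
  induction l with
  | zero => rfl
  | succ l ih =>
    rw [← add_assoc, continuation, Function.update_of_ne, ih]
    push_cast
    omega

lemma regressor_congr {m p : ℕ} {s s' u u' : ℤ → ℝ} {k : ℤ} (hs : ∀ i ≤ k, s i = s' i)
    (hu : ∀ i < k + p, u i = u' i) : regressor m p s u k = regressor m p s' u' k := by
  funext x
  rcases x with (i | j) | l
  · simpa [regressor, stateOf] using hs _ (by omega)
  · simpa [regressor, stateOf] using hu _ (by omega)
  · simpa [regressor] using hu _ (by omega)

/-- A past of the system with admissible inputs up to time `K` extends to a trajectory. -/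
lemma exists_trajectory {z u v d : ℤ → ℝ} (harx : S.IsARX z u v) (hd : ∀ k, |d k| ≤ S.dbar)
    (hv : ∀ k, |v k| ≤ S.vbar) (hz : ∃ b, ∀ k ≤ 0, |z k| ≤ b) {K : ℤ} (hK : 0 ≤ K)
    (hu : ∀ k ≤ K, u k ∈ S.U) :
    ∃ z' u', S.IsTrajectory z' u' v d ∧ (∀ i ≤ K + 1, z' i = z i) ∧ ∀ i ≤ K, u' i = u i := by
  -- The input is frozen after time `K`, since nothing is known about its later values; the output
  -- is then recomputed from time `K + 2` on.
  let u' : ℤ → ℝ := fun i => u (min i K)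
  have hu' : ∀ i ≤ K, u' i = u i := fun i hi => by simp [u', hi]
  let F := S.continuation z u' v (K + 1)
  -- Diagonal choice: time `i` is read off the first stage at which its value is final; `toNat`
  -- returns stage `0` for the past.
  let z' : ℤ → ℝ := fun i => F (i - (K + 1)).toNat i
  have key : ∀ (j : ℕ) (i : ℤ), i ≤ K + 1 + j → z' i = F j i := by
    intro j i hi
    have hle : (i - (K + 1)).toNat ≤ j := by omega
    obtain ⟨l, rfl⟩ := Nat.exists_eq_add_of_le hle
    exact (continuation_of_le z u' v (K + 1) _ i (by omega) l).symm
  have hz' : ∀ i ≤ K + 1, z' i = z i := fun i hi => key 0 i (by simpa using hi)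
  refine ⟨z', u', ⟨?_, ?_, hd, hv, ?_⟩, hz', hu'⟩
  · intro k
    rcases le_or_gt k K with hk | hk
    · rw [hz' _ (by omega), harx k,
        regressor_congr (s := z') (s' := z) (u := u') (u' := u) (fun i hi => hz' i (by omega))
          (fun i hi => hu' i (by push_cast at hi; omega))]
    · obtain ⟨j, rfl⟩ : ∃ j : ℕ, k = K + 1 + j := ⟨(k - (K + 1)).toNat, by omega⟩
      rw [key (j + 1) _ (by push_cast; omega),
        regressor_congr (s := z') (s' := F j) (u := u') (u' := u') (fun i hi => key j i hi)
          (fun _ _ => rfl)]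
      simp only [F, continuation, Function.update_self]
  · intro k
    exact hu _ (min_le_right _ _)
  · obtain ⟨b, hb⟩ := hz
    exact ⟨b, fun k hk => by rw [hz' k (by omega)]; exact hb k hk⟩

end Plant

/-! ### Error bounds certified by the learning phase -/

namespace Learning

variable {o : ℕ} {D : Learning o} {S : Plant}

/-- The feasible parameter set contains a parameter for which the inflated error bound is valid on
all compatible pairs. -/
lemma exists_mem_fps {pbar p : ℕ} (hD : D.Standing S pbar) (hp : p ∈ Finset.Icc 1 pbar) :
    ∃ θ ∈ D.fps S p, ∀ x ∈ S.pairSet o p, |x.2 - θ ⬝ᵥ x.1| ≤ D.epsHat S p + S.dbar := by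
  -- The bound `ε̄*` is an infimum, so a parameter is known only for every positive slack. The sets
  -- for slack `1 / (n + 1)` are nested, compact and nonempty; a common point works with slack zero.
  let F : ℕ → Set (Reg o p) := fun n =>
    D.Ω p ∩ {θ | ∀ x ∈ S.pairSet o p,
      |x.2 - θ ⬝ᵥ x.1| ≤ D.epsHat S p + 1 / ((n : ℝ) + 1) + S.dbar}
  have hcl : ∀ n, IsClosed (F n) := by
    intro n
    refine (hD.Ω_compact p hp).isClosed.inter ?_
    simp only [Set.ofPred_forall]
    refine isClosed_biInter fun x _ => isClosed_le ?_ continuous_const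
    exact (continuous_const.sub (by fun_prop)).abs
  have hne : ∀ n, (F n).Nonempty := by
    intro n
    have h1 : D.optimalBound S p < ((D.epsHat S p + 1 / ((n : ℝ) + 1) : ℝ) : EReal) :=
      (hD.bound_le p hp).trans_lt
        (EReal.coe_lt_coe_iff.2 (lt_add_of_pos_right _ Nat.one_div_pos_of_nat))
    simp only [optimalBound, Plant.errorBound, iInf_lt_iff] at h1
    obtain ⟨θ, hθ, e, he, hlt⟩ := h1
    refine ⟨θ, hθ, fun x hx => (he x hx).trans ?_⟩
    have := (EReal.coe_lt_coe_iff.1 hlt).le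
    linarith
  have hmono : ∀ n, F (n + 1) ⊆ F n := by
    rintro n θ ⟨h1, h2⟩
    refine ⟨h1, fun x hx => (h2 x hx).trans ?_⟩
    have : 1 / (((n + 1 : ℕ) : ℝ) + 1) ≤ 1 / ((n : ℝ) + 1) :=
      Nat.one_div_le_one_div (Nat.le_succ n)
    linarith
  obtain ⟨θ, hθ⟩ := IsCompact.nonempty_iInter_of_sequence_nonempty_isCompact_isClosed F hmono hne
    ((hD.Ω_compact p hp).of_isClosed_subset (hcl 0) Set.inter_subset_left) hcl
  rw [Set.mem_iInter] at hθ
  have hb : ∀ x ∈ S.pairSet o p, |x.2 - θ ⬝ᵥ x.1| ≤ D.epsHat S p + S.dbar := by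
    intro x hx
    have ht : Tendsto (fun n : ℕ => D.epsHat S p + 1 / ((n : ℝ) + 1) + S.dbar) atTop
        (𝓝 (D.epsHat S p + 0 + S.dbar)) :=
      (tendsto_const_nhds.add tendsto_one_div_add_atTop_nhds_zero_nat).add tendsto_const_nhds
    rw [add_zero] at ht
    exact ge_of_tendsto' ht fun n => (hθ n).2 x hx
  exact ⟨θ, ⟨(hθ 0).1, fun i => hb _ (hD.data_mem p hp i)⟩, hb⟩

/-- If `τ_p(θ) ≤ t`, then `t + d̄` bounds the prediction error of `θ` on all compatible pairs. -/
lemma abs_sub_le_of_tau_le {pbar p : ℕ} (hD : D.Standing S pbar) (hp : p ∈ Finset.Icc 1 pbar)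
    {θ : Reg o p} {t : ℝ} (ht : D.tau S p θ ≤ (t : EReal)) {x : Reg o p × ℝ}
    (hx : x ∈ S.pairSet o p) : |x.2 - θ ⬝ᵥ x.1| ≤ t + S.dbar := by
  obtain ⟨θ', hθ', hb⟩ := exists_mem_fps hD hp
  have hφ : x.1 ∈ S.regressorSet o p := by
    obtain ⟨z, u, v, d, h, k, rfl⟩ := hx
    exact ⟨z, u, v, d, h, k, rfl⟩
  have h1 : ((|(θ' - θ) ⬝ᵥ x.1| : ℝ) : EReal) ≤
      ⨆ φ ∈ S.regressorSet o p, ⨆ θ' ∈ D.fps S p, ((|(θ' - θ) ⬝ᵥ φ| : ℝ) : EReal) :=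
    le_iSup₂_of_le x.1 hφ
      (le_iSup₂ (f := fun θ' (_ : θ' ∈ D.fps S p) => ((|(θ' - θ) ⬝ᵥ x.1| : ℝ) : EReal)) θ' hθ')
  have h2 : ((|(θ' - θ) ⬝ᵥ x.1| + D.epsHat S p : ℝ) : EReal) ≤ t := by
    refine le_trans ?_ ht
    rw [EReal.coe_add]
    exact add_le_add h1 le_rfl
  have h3 := EReal.coe_le_coe_iff.1 h2
  have h4 := hb x hx
  have h5 : x.2 - θ ⬝ᵥ x.1 = (x.2 - θ' ⬝ᵥ x.1) + (θ' - θ) ⬝ᵥ x.1 := by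
    rw [sub_dotProduct]; ring
  rw [h5]
  exact (abs_add_le _ _).trans (by linarith)

end Learning

/-- The residual of a one-step-ahead model along the trajectories of the system is bounded by any
number that dominates its error bound. -/
lemma abs_residual_le {o pbar : ℕ} {D : Learning o} {S : Plant} (hpos : 0 < o) (hp : 1 ≤ pbar)
    (hS : 0 ≤ S.dbar) (hD : D.Standing S pbar) {θ : Reg o 1} (hτ : D.BoundsValid S pbar θ) {w : ℝ}
    (hw : w ∈ D.disturbanceBounds S pbar θ) {z u v d : ℤ → ℝ} (h : S.IsTrajectory z u v d)
    (k : ℤ) : |z (k + 1) - θ ⬝ᵥ regressor o 1 z u k| ≤ w := by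
  have h1 : 1 ∈ Finset.Icc 1 pbar := Finset.mem_Icc.2 ⟨le_rfl, hp⟩
  have hb := hw.2 1 h1
  have ht := (hτ 1 h1).trans (EReal.coe_le_coe_iff.2 hb)
  rw [iterated_one hpos] at ht
  simp only [Finset.range_one, Finset.sum_singleton, pow_zero, one_mulVec, pow_one,
    vecC_vecMul_matA hpos, vecC_dotProduct hpos, vecM, Sum.elim_inl, if_true, abs_one,
    one_mul] at ht
  set a := z (k + 1) - θ ⬝ᵥ regressor o 1 z u k with ha
  -- A sign of `a` with `|s| = 1` even for `a = 0`, where `SignType.sign` would vanish.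
  obtain ⟨s, hs, hsa⟩ : ∃ s : ℝ, |s| = 1 ∧ s * a = |a| := by
    rcases le_total 0 a with h0 | h0
    · exact ⟨1, by simp, by rw [abs_of_nonneg h0, one_mul]⟩
    · exact ⟨-1, by simp, by rw [abs_of_nonpos h0]; ring⟩
  have hsign : ∀ x : ℝ, |(SignType.sign x : ℝ)| ≤ 1 := by
    intro x
    rcases lt_trichotomy x 0 with hx | rfl | hx <;> simp [*]
  -- The autoregressive coefficients as a function on `ℤ`. At times that do not enter the regressor
  -- its value is irrelevant.
  let g : ℤ → ℝ := fun i => if h : i.toNat < o then θ (.inl (.inl ⟨i.toNat, h⟩)) else 0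
  -- Worst-case noise: the error in the new output and the errors in all regressor entries push the
  -- prediction error in the direction of `a`.
  let d' : ℤ → ℝ := fun i =>
    if i = k + 1 then s * S.dbar else -(s * (SignType.sign (g (k - i)) : ℝ) * S.dbar)
  have hd' : ∀ i, |d' i| ≤ S.dbar := by
    intro i
    by_cases hi : i = k + 1
    · simp [d', hi, abs_mul, hs, abs_of_nonneg hS]
    · simp only [d', hi, if_false, abs_neg, abs_mul, hs, one_mul, abs_of_nonneg hS]
      exact mul_le_of_le_one_left hS (hsign _)
  have hx : ((regressor o 1 (z + d') u k, z (k + (1 : ℕ)) + d' (k + (1 : ℕ))) : Reg o 1 × ℝ)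
      ∈ S.pairSet o 1 := ⟨z, u, v, d', h.congr_noise hd', k, rfl⟩
  have hle := Learning.abs_sub_le_of_tau_le hD h1 ht hx
  have hreg : θ ⬝ᵥ regressor o 1 (z + d') u k
      = θ ⬝ᵥ regressor o 1 z u k + ∑ i : Fin o, θ (.inl (.inl i)) * d' (k - (i : ℕ)) := by
    simp only [dotProduct, regressor, stateOf, Fintype.sum_sum_type, Sum.elim_inl, Sum.elim_inr,
      Pi.add_apply, mul_add, Finset.sum_add_distrib]
    ring
  have hsum : ∑ i : Fin o, θ (.inl (.inl i)) * d' (k - (i : ℕ))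
      = -(s * ((∑ i : Fin o, |θ (.inl (.inl i))|) * S.dbar)) := by
    rw [Finset.sum_mul, Finset.mul_sum, ← Finset.sum_neg_distrib]
    refine Finset.sum_congr rfl fun i _ => ?_
    have hne : k - ((i : ℕ) : ℤ) ≠ k + 1 := by omega
    have hg : g (k - (k - ((i : ℕ) : ℤ))) = θ (.inl (.inl i)) := by simp [g]
    simp only [d', hne, if_false, hg]
    rw [← self_mul_sign]
    ring
  have hd1 : d' (k + (1 : ℕ)) = s * S.dbar := by simp [d']
  have heq : z (k + (1 : ℕ)) + d' (k + (1 : ℕ)) - θ ⬝ᵥ regressor o 1 (z + d') u k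
      = a + s * S.dbar + s * ((∑ i : Fin o, |θ (.inl (.inl i))|) * S.dbar) := by
    rw [hreg, hsum, hd1, ha]
    push_cast
    ring
  simp only [heq] at hle
  have hss : s * s = 1 := by rw [← abs_mul_abs_self, hs, one_mul]
  have h2 : s * (a + s * S.dbar + s * ((∑ i : Fin o, |θ (.inl (.inl i))|) * S.dbar))
      = |a| + S.dbar + (∑ i : Fin o, |θ (.inl (.inl i))|) * S.dbar := by
    linear_combination hsa + (S.dbar + (∑ i : Fin o, |θ (.inl (.inl i))|) * S.dbar) * hss
  have h3 := le_abs_self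
    (s * (a + s * S.dbar + s * ((∑ i : Fin o, |θ (.inl (.inl i))|) * S.dbar)))
  rw [abs_mul, hs, one_mul, h2] at h3
  linarith

end LearnedMPC

namespace LearnedMPC

namespace Controller

variable {o pbar : ℕ} (c : Controller o pbar)

/-! ### Recursive feasibility -/

lemma AK_mulVec (x : State o) : c.AK *ᵥ x = c.A *ᵥ x + (c.K ⬝ᵥ x) • c.B₁ := by
  rw [AK, add_mulVec, vecMulVec_mulVec, op_smul_eq_smul]

lemma AL_mulVec (x : State o) : c.AL *ᵥ x = c.A *ᵥ x - (vecC o ⬝ᵥ x) • c.L := by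
  rw [AL, sub_mulVec, vecMulVec_mulVec, op_smul_eq_smul]

/-- The input at stage `j` of the horizon (`0` beyond it). -/
noncomputable def inputAt (w : Fin (pbar + 1) → ℝ) (j : ℕ) : ℝ := if h : j < pbar + 1 then w ⟨j, h⟩ else 0

@[simp] lemma inputAt_val (w : Fin (pbar + 1) → ℝ) (p : Fin (pbar + 1)) : inputAt w p = w p :=
  dif_pos p.2

lemma predict_succ (s : Decision o pbar) (j : ℕ) :
    c.predict s (j + 1)
      = c.A *ᵥ c.predict s j + inputAt s.U j • c.B₁ + (c.η * s.zref) • vecM o := rfl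

lemma predict_one (s : Decision o pbar) :
    c.predict s 1 = c.A *ᵥ s.X + s.U 0 • c.B₁ + (c.η * s.zref) • vecM o := by
  rw [predict_succ]
  simp [predict, inputAt]

/-- The inputs shifted by one stage, completed by `a`. -/
noncomputable def shiftInput (w : Fin (pbar + 1) → ℝ) (a : ℝ) : Fin (pbar + 1) → ℝ :=
  fun j => if h : (j : ℕ) + 1 < pbar + 1 then w ⟨j + 1, h⟩ else a

lemma inputAt_shiftInput_of_lt (w : Fin (pbar + 1) → ℝ) (a : ℝ) {j : ℕ} (hj : j < pbar) :
    inputAt (shiftInput w a) j = inputAt w (j + 1) := by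
  simp [inputAt, shiftInput, hj, Nat.lt_succ_of_lt hj]

lemma inputAt_shiftInput_last (w : Fin (pbar + 1) → ℝ) (a : ℝ) :
    inputAt (shiftInput w a) pbar = a := by
  simp [inputAt, shiftInput]

/-- The candidate decision for the next time: the tail of the old one, completed by the auxiliary
control law. -/
noncomputable def shift (s : Decision o pbar) : Decision o pbar where
  X := c.predict s 1
  U := shiftInput s.U (c.K ⬝ᵥ c.predict s (pbar + 1) + c.M₂ * s.zref)
  zref := s.zref

lemma predict_shift (s : Decision o pbar) {j : ℕ} (hj : j ≤ pbar) :
    c.predict (c.shift s) j = c.predict s (j + 1) := by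
  induction j with
  | zero => rfl
  | succ j ih =>
    rw [predict_succ, ih (by omega), predict_succ c s (j + 1)]
    simp only [shift]
    rw [inputAt_shiftInput_of_lt _ _ (by omega)]

/-- The appended input is the auxiliary law, so the last prediction step is one step of the
auxiliary system. -/
lemma predict_shift_last (s : Decision o pbar) :
    (c.predict (c.shift s) (pbar + 1), s.zref)
      = c.auxStep (c.predict s (pbar + 1), s.zref) := by
  rw [predict_succ, predict_shift c s le_rfl]
  simp only [shift, inputAt_shiftInput_last, auxStep, AK_mulVec, add_smul]
  congr 2
  abel

lemma auxStep_mem_terminalSet {x : State o × ℝ} (hx : x ∈ c.terminalSet) :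
    c.auxStep x ∈ c.terminalSet := by
  obtain ⟨h1, y, hy, h2⟩ := hx
  refine ⟨fun k => ?_, y, hy, ?_⟩
  · simpa only [← Function.iterate_succ_apply] using h1 (k + 1)
  · simp only [← Function.iterate_succ_apply]
    exact h2.comp (tendsto_add_atTop_nat 1)

variable {c}

/-- All stages but the last are inherited. The last input and output constraints are the time-zero
condition in the terminal set, which is itself invariant under the auxiliary step. -/
lemma Admissible.shift {Xh Xh' : State o} {s : Decision o pbar} (hs : c.Admissible Xh s)
    (hX : Xh' - c.predict s 1 ∈ c.Ebar) : c.Admissible Xh' (c.shift s) where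
  initial := hX
  input := by
    intro p
    by_cases h : (p : ℕ) + 1 < pbar + 1
    · simpa [Controller.shift, shiftInput, h] using hs.input ⟨p + 1, h⟩
    · have := (hs.terminal.1 0).2.1
      simp only [Controller.shift, shiftInput, h, dif_neg, not_false_eq_true]
      exact this
  output := by
    intro p
    by_cases h : (p : ℕ) + 1 < pbar + 1
    · rw [predict_shift c s (by omega)]
      exact hs.output ⟨p + 1, h⟩
    · have hp : (p : ℕ) = pbar := by omega
      rw [predict_shift c s (by omega), hp]
      exact (hs.terminal.1 0).1
  estimate := hs.estimate
  terminal := by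
    have := auxStep_mem_terminalSet c hs.terminal
    rwa [← predict_shift_last] at this

end Controller

/-! ### Invariance of the errors along the closed loop -/

namespace IsClosedLoop

open Controller

variable {o pbar : ℕ} {S : Plant} {c : Controller o pbar} {Z : Set ℝ} {σ zgoal : ℝ}
  {r : Signals o pbar}

/-- The estimation error at time `k`. -/
noncomputable def _root_.LearnedMPC.Signals.err (r : Signals o pbar) (k : ℕ) : State o :=
  stateOf o r.z r.u k - r.Xhat k

lemma input_mem (h : IsClosedLoop S c σ zgoal r) (hc : c.WellDesigned S Z) {k : ℕ}
    (hk : c.Feasible (r.Xhat k)) : r.u k ∈ S.U := by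
  have hs := (h.optimal k hk).1
  rw [h.law k]
  exact hc.Ubar_sub (hs.input 0) _ ⟨_, hs.initial, rfl⟩

lemma output_mem (h : IsClosedLoop S c σ zgoal r) (hc : c.WellDesigned S Z) (hpos : 0 < o) {k : ℕ}
    (hk : c.Feasible (r.Xhat k)) (he : r.err k ∈ c.Ehat) : r.z k ∈ Z := by
  have hs := (h.optimal k hk).1
  have hz := hc.Zbar_sub (hs.output 0) _ ⟨(r.Xhat k - (r.sol k).X, r.err k),
    ⟨hs.initial, he⟩, rfl⟩
  have : vecC o ⬝ᵥ c.predict (r.sol k) (0 : Fin (pbar + 1))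
      + vecC o ⬝ᵥ (r.Xhat k - (r.sol k).X + r.err k) = r.z k := by
    rw [← dotProduct_add]
    simp only [Fin.val_zero, predict, Signals.err]
    rw [vecC_dotProduct hpos]
    simp [stateOf]
  simpa only [this] using hz

/-- The disturbance acting on the estimation error is the residual of the learned model minus its
estimate. -/
lemma err_succ (h : IsClosedLoop S c σ zgoal r) (hpos : 0 < o) (k : ℕ) :
    r.err (k + 1) = c.AL *ᵥ r.err k
      + (r.z (k + 1) - c.θ 1 ⬝ᵥ regressor o 1 r.z r.u k - c.η * (r.sol k).zref) • vecM o
      - r.d k • c.L := by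
  have hz : r.z k = vecC o ⬝ᵥ stateOf o r.z r.u k := by
    rw [vecC_dotProduct hpos]; simp [stateOf]
  simp only [Signals.err, Nat.cast_succ]
  rw [h.observer k, stateOf_succ (c.θ 1), AL_mulVec, hz]
  simp only [mulVec_sub, dotProduct_sub, sub_smul, add_smul, B₁, A]
  abel

/-- Observer and nominal model use the same `ŵ`, so it cancels; only the output injection through
`L` remains. -/
lemma deviation_succ (h : IsClosedLoop S c σ zgoal r) (hpos : 0 < o) (k : ℕ) :
    r.Xhat (k + 1) - c.predict (r.sol k) 1 = c.AK *ᵥ (r.Xhat k - (r.sol k).X)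
      + (vecC o ⬝ᵥ r.err k) • c.L + r.d k • c.L := by
  have hz : r.z k = vecC o ⬝ᵥ stateOf o r.z r.u k := by
    rw [vecC_dotProduct hpos]; simp [stateOf]
  simp only [Signals.err]
  rw [h.observer k, predict_one, AK_mulVec, h.law k, hz]
  simp only [mulVec_sub, dotProduct_sub, sub_smul, add_smul]
  abel

lemma deviation_mem (h : IsClosedLoop S c σ zgoal r) (hc : c.WellDesigned S Z) (hpos : 0 < o)
    {k : ℕ} (hk : c.Feasible (r.Xhat k)) (he : r.err k ∈ c.Ehat) :
    r.Xhat (k + 1) - c.predict (r.sol k) 1 ∈ c.Ebar := by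
  rw [h.deviation_succ hpos]
  exact hc.Ebar_rpi _ (h.optimal k hk).1.initial _ he _ (h.noise k)

/-- Recursive feasibility, with invariance of the estimation error. -/
lemma feasible_and_err_mem (h : IsClosedLoop S c σ zgoal r) (hc : c.WellDesigned S Z)
    (hpos : 0 < o)
    (hres : ∀ z u v d, S.IsTrajectory z u v d → ∀ k,
      |z (k + 1) - c.θ 1 ⬝ᵥ regressor o 1 z u k| ≤ c.wbar)
    (h0 : c.Feasible (r.Xhat 0)) (k : ℕ) :
    c.Feasible (r.Xhat k) ∧ r.err k ∈ c.Ehat := by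
  -- Strong induction, because the comparison trajectory needs admissible inputs at all earlier
  -- times.
  induction k using Nat.strong_induction_on with
  | _ k ih =>
    rcases k with _ | k
    · exact ⟨h0, h.initial⟩
    · obtain ⟨hk, he⟩ := ih k (Nat.lt_succ_self k)
      have hu : ∀ i ≤ (k : ℤ), r.u i ∈ S.U := by
        intro i hi
        rcases lt_or_ge i 0 with hi0 | hi0
        · exact h.past_input i hi0
        · lift i to ℕ using hi0
          exact h.input_mem hc (ih i (by omega)).1
      obtain ⟨z', u', htraj, hz', hu'⟩ := Plant.exists_trajectory h.arx h.noise h.disturbance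
        h.past_bounded (Int.natCast_nonneg k) hu
      have hw := hres z' u' _ _ htraj k
      rw [hz' _ le_rfl, Plant.regressor_congr (s' := r.z) (u' := r.u) (fun i hi => hz' i (by omega))
        (fun i hi => hu' i (by push_cast at hi; omega))] at hw
      refine ⟨⟨_, (h.optimal k hk).1.shift (h.deviation_mem hc hpos hk he)⟩, ?_⟩
      rw [h.err_succ hpos]
      refine hc.Ehat_rpi _ he _ _ ?_ (h.noise k)
      -- Residual and estimate are each bounded by `wbar`, whence the factor `2` in the invariance
      -- of `Ê`.
      have h2 : |c.η * (r.sol k).zref| ≤ c.wbar := (h.optimal k hk).1.estimate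
      exact (abs_sub _ _).trans (by linarith)

end IsClosedLoop

end LearnedMPC

namespace LearnedMPC

/-! ### Quadratic forms -/

section QuadraticForms

variable {ι : Type*} [Fintype ι]

lemma smul_quad (M : Matrix ι ι ℝ) (t : ℝ) (x : ι → ℝ) :
    (t • x) ⬝ᵥ (M *ᵥ (t • x)) = t ^ 2 * (x ⬝ᵥ (M *ᵥ x)) := by
  rw [mulVec_smul, dotProduct_smul, smul_dotProduct, smul_eq_mul, smul_eq_mul]
  ring

lemma quad_parallelogram (M : Matrix ι ι ℝ) (x y : ι → ℝ) :
    (x + y) ⬝ᵥ (M *ᵥ (x + y)) + (x - y) ⬝ᵥ (M *ᵥ (x - y))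
      = 2 * (x ⬝ᵥ (M *ᵥ x)) + 2 * (y ⬝ᵥ (M *ᵥ y)) := by
  simp only [mulVec_add, mulVec_sub, dotProduct_add, dotProduct_sub, add_dotProduct,
    sub_dotProduct]
  ring

/-- In finite dimension, a positive definite quadratic form dominates every other one. -/
lemma exists_quad_le_mul_quad (P Q : Matrix ι ι ℝ) (hQ : ∀ x, x ≠ 0 → 0 < x ⬝ᵥ (Q *ᵥ x)) :
    ∃ b : ℝ, 0 < b ∧ ∀ x, x ⬝ᵥ (P *ᵥ x) ≤ b * (x ⬝ᵥ (Q *ᵥ x)) := by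
  have hcP : Continuous fun x : ι → ℝ => x ⬝ᵥ (P *ᵥ x) := by fun_prop
  have hcQ : Continuous fun x : ι → ℝ => x ⬝ᵥ (Q *ᵥ x) := by fun_prop
  have hQ' : ∀ x ∈ Metric.sphere (0 : ι → ℝ) 1, 0 < x ⬝ᵥ (Q *ᵥ x) := by
    intro x hx
    refine hQ x fun h => ?_
    simp [h] at hx
  obtain ⟨b, hb⟩ := (isCompact_sphere (0 : ι → ℝ) 1).bddAbove_image
    (f := fun x => (x ⬝ᵥ (P *ᵥ x)) / (x ⬝ᵥ (Q *ᵥ x)))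
    (hcP.continuousOn.div hcQ.continuousOn fun x hx => (hQ' x hx).ne')
  refine ⟨max b 1, lt_max_of_lt_right one_pos, fun x => ?_⟩
  by_cases hx : x = 0
  · simp [hx]
  · have hn : ‖x‖ ≠ 0 := norm_ne_zero_iff.2 hx
    have hs : ‖x‖⁻¹ • x ∈ Metric.sphere (0 : ι → ℝ) 1 := by
      simp [norm_smul, hn]
    have h1 := hb ⟨_, hs, rfl⟩
    simp only [smul_quad] at h1
    rw [mul_div_mul_left _ _ (pow_ne_zero 2 (inv_ne_zero hn)), div_le_iff₀ (hQ x hx)] at h1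
    exact h1.trans (mul_le_mul_of_nonneg_right (le_max_left _ _) (hQ x hx).le)

lemma PosDef.quad_pos {M : Matrix ι ι ℝ} (hM : M.PosDef) (x : ι → ℝ) (hx : x ≠ 0) :
    0 < x ⬝ᵥ (M *ᵥ x) := by
  simpa using hM.dotProduct_mulVec_pos hx

lemma PosSemidef.quad_nonneg {M : Matrix ι ι ℝ} (hM : M.PosSemidef) (x : ι → ℝ) :
    0 ≤ x ⬝ᵥ (M *ᵥ x) := by
  simpa using hM.dotProduct_mulVec_nonneg x

lemma quad_transpose_mul_mul {κ : Type*} [Fintype κ] (M : Matrix κ ι ℝ) (Q : Matrix κ κ ℝ)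
    (x : ι → ℝ) : x ⬝ᵥ ((Mᵀ * Q * M) *ᵥ x) = (M *ᵥ x) ⬝ᵥ (Q *ᵥ (M *ᵥ x)) := by
  rw [← mulVec_mulVec, ← mulVec_mulVec, dotProduct_mulVec, vecMul_transpose]

lemma quad_diagonal [DecidableEq ι] (q x : ι → ℝ) :
    x ⬝ᵥ (diagonal q *ᵥ x) = ∑ i, q i * x i ^ 2 := by
  simp only [dotProduct, mulVec_diagonal]
  exact Finset.sum_congr rfl fun i _ => by ring

end QuadraticForms

namespace Controller

variable {o pbar : ℕ} (c : Controller o pbar)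

/-! ### Deviations from the steady state -/

/-- State `j` of the disturbance-free nominal system, from the state `x`, under the inputs `w`. -/
noncomputable def traj (x : State o) (w : Fin (pbar + 1) → ℝ) : ℕ → State o
  | 0 => x
  | j + 1 => c.A *ᵥ traj x w j + inputAt w j • c.B₁

/-- The part of the cost that penalizes the deviations `x`, `w` of the nominal state and inputs from
the steady state. -/
noncomputable def trackingCost (x : State o) (w : Fin (pbar + 1) → ℝ) : ℝ :=
  ∑ p : Fin (pbar + 1),
      (c.Q p * (c.Cp p ⬝ᵥ x + c.Dp p ⬝ᵥ w) ^ 2 + c.R p * w p ^ 2)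
    + c.traj x w (pbar + 1) ⬝ᵥ (c.P *ᵥ c.traj x w (pbar + 1))

/-- Deviation of the nominal state from the steady state. -/
noncomputable def devX (s : Decision o pbar) : State o := s.X - s.zref • c.Nvec

/-- Deviation of the nominal inputs from the steady state. -/
noncomputable def devU (s : Decision o pbar) : Fin (pbar + 1) → ℝ :=
  fun p => s.U p - c.μ⁻¹ * s.zref

lemma traj_add (x y : State o) (w v : Fin (pbar + 1) → ℝ) (j : ℕ) :
    c.traj (x + y) (w + v) j = c.traj x w j + c.traj y v j := by
  induction j with
  | zero => rfl
  | succ j ih =>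
    have : inputAt (w + v) j = inputAt w j + inputAt v j := by
      unfold inputAt; split_ifs <;> simp
    simp only [traj, ih, this, mulVec_add, add_smul]
    abel

lemma traj_smul (t : ℝ) (x : State o) (w : Fin (pbar + 1) → ℝ) (j : ℕ) :
    c.traj (t • x) (t • w) j = t • c.traj x w j := by
  induction j with
  | zero => rfl
  | succ j ih =>
    have : inputAt (t • w) j = t * inputAt w j := by
      unfold inputAt; split_ifs <;> simp
    simp only [traj, ih, this, mulVec_smul, smul_add, smul_smul]

lemma traj_sub (x y : State o) (w v : Fin (pbar + 1) → ℝ) (j : ℕ) :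
    c.traj (x - y) (w - v) j = c.traj x w j - c.traj y v j := by
  have h1 := c.traj_smul (-1) y v j
  have h2 := c.traj_add x ((-1 : ℝ) • y) w ((-1 : ℝ) • v) j
  rw [h1] at h2
  simpa only [neg_smul, one_smul, ← sub_eq_add_neg] using h2

lemma traj_eq_sum (x : State o) (w : Fin (pbar + 1) → ℝ) (j : ℕ) :
    c.traj x w j = c.A ^ j *ᵥ x
      + ∑ i ∈ Finset.range j, inputAt w i • (c.A ^ (j - 1 - i) *ᵥ c.B₁) := by
  induction j with
  | zero => simp [traj]
  | succ j ih =>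
    rw [traj, ih, mulVec_add, mulVec_mulVec, ← pow_succ', Finset.sum_range_succ, mulVec_sum,
      add_assoc]
    congr 2
    · refine Finset.sum_congr rfl fun i hi => ?_
      rw [mulVec_smul, mulVec_mulVec, ← pow_succ']
      have := Finset.mem_range.1 hi
      congr 4
      omega
    · simp

lemma traj_last (x : State o) (w : Fin (pbar + 1) → ℝ) :
    c.traj x w (pbar + 1) = c.A ^ (pbar + 1) *ᵥ x + c.Γ *ᵥ w := by
  rw [traj_eq_sum, Finset.sum_range]
  congr 1
  funext i
  simp only [Finset.sum_apply, Γ, mulVec, dotProduct, of_apply, inputAt_val, Pi.smul_apply,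
    smul_eq_mul, Nat.add_sub_cancel]
  exact Finset.sum_congr rfl fun j _ => mul_comm _ _

lemma traj_shift (x : State o) (w : Fin (pbar + 1) → ℝ) (a : ℝ) {j : ℕ} (hj : j ≤ pbar) :
    c.traj (c.traj x w 1) (shiftInput w a) j = c.traj x w (j + 1) := by
  induction j with
  | zero => rfl
  | succ j ih =>
    rw [traj, ih (by omega), inputAt_shiftInput_of_lt _ _ (by omega), traj.eq_2 (j := j + 1)]

lemma traj_shift_last (x : State o) (w : Fin (pbar + 1) → ℝ) :
    c.traj (c.traj x w 1) (shiftInput w (c.K ⬝ᵥ c.traj x w (pbar + 1))) (pbar + 1)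
      = c.AK *ᵥ c.traj x w (pbar + 1) := by
  rw [traj, traj_shift c _ _ _ le_rfl, inputAt_shiftInput_last, AK_mulVec]

lemma traj_one (x : State o) (w : Fin (pbar + 1) → ℝ) :
    c.traj x w 1 = c.A *ᵥ x + w 0 • c.B₁ := by
  simp [traj, inputAt]

/-- `N` is the steady state for unit reference. -/
lemma steady_state (ho : 0 < o) :
    c.A *ᵥ c.Nvec + c.μ⁻¹ • c.B₁ + c.η • vecM o = c.Nvec := by
  -- `η` is the defect of the first row of the steady-state equation; the shift rows hold for any
  -- gain estimate.
  have hη : c.η = 1 - (fun i => c.θ 1 (.inl i)) ⬝ᵥ c.Nvec - c.μ⁻¹ * c.θ 1 (.inr 0) := by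
    have h := vecC_dotProduct ho ((1 - c.A) *ᵥ c.Nvec - c.μ⁻¹ • c.B₁)
    rw [η, show vecM o = vecC o from rfl, h, sub_mulVec, one_mulVec]
    simp only [Pi.sub_apply, Pi.smul_apply, smul_eq_mul, A]
    rw [matA_mulVec_inl_zero _ _ _ rfl]
    simp [Nvec, B₁, vecB]
  rw [hη]
  funext x
  simp only [Pi.add_apply, Pi.smul_apply, smul_eq_mul, A]
  rcases x with ⟨i, hi⟩ | ⟨j, hj⟩
  · rcases i with _ | i
    · rw [matA_mulVec_inl_zero _ _ _ rfl]
      simp [Nvec, B₁, vecB, vecM]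
    · rw [matA_mulVec_inl_succ]
      simp [Nvec, B₁, vecB, vecM]
  · rcases j with _ | j
    · rw [matA_mulVec_inr_zero _ _ _ rfl]
      simp [Nvec, B₁, vecB, vecM]
    · rw [matA_mulVec_inr_succ]
      simp [Nvec, B₁, vecB, vecM]

/-- Superposition about the steady state: the constant disturbance `η zref` is absorbed by `zref •
N`, and the deviations follow the disturbance-free dynamics. -/
lemma predict_eq (ho : 0 < o) (s : Decision o pbar) {j : ℕ} (hj : j ≤ pbar + 1) :
    c.predict s j = s.zref • c.Nvec + c.traj (c.devX s) (c.devU s) j := by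
  induction j with
  | zero => simp [predict, traj, devX]
  | succ j ih =>
    have hU : inputAt s.U j = inputAt (c.devU s) j + s.zref * c.μ⁻¹ := by
      simp only [inputAt, dif_pos (show j < pbar + 1 by omega), devU]
      ring
    rw [predict_succ, ih (by omega), traj, hU, mulVec_add, mulVec_smul, mul_comm c.η]
    nth_rewrite 2 [← c.steady_state ho]
    simp only [smul_add, add_smul, mul_smul]
    abel

lemma cost_eq (ho : 0 < o) (σ zgoal : ℝ) (s : Decision o pbar) :
    c.cost σ zgoal s
      = c.trackingCost (c.devX s) (c.devU s) + σ * (s.zref - zgoal) ^ 2 := by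
  rw [cost, trackingCost, c.predict_eq ho s le_rfl, add_sub_cancel_left]
  congr 2
  refine Finset.sum_congr rfl fun p _ => ?_
  have hU : c.devU s = s.U - fun _ => c.μ⁻¹ * s.zref := rfl
  rw [refOut, devX, hU, dotProduct_sub, dotProduct_sub]
  simp only [Pi.sub_apply]
  ring

lemma devX_shift (ho : 0 < o) (s : Decision o pbar) :
    c.devX (c.shift s) = c.traj (c.devX s) (c.devU s) 1 := by
  rw [devX, shift, c.predict_eq ho s (by omega)]
  simp

/-- `M₂` compensates `K N`, so in deviation variables the auxiliary law is pure state feedback. -/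
lemma K_predict_last (ho : 0 < o) (s : Decision o pbar) :
    c.K ⬝ᵥ c.predict s (pbar + 1) + c.M₂ * s.zref
      = c.K ⬝ᵥ c.traj (c.devX s) (c.devU s) (pbar + 1) + c.μ⁻¹ * s.zref := by
  rw [c.predict_eq ho s le_rfl, dotProduct_add, dotProduct_smul, M₂, smul_eq_mul]
  ring

lemma devU_shift (ho : 0 < o) (s : Decision o pbar) :
    c.devU (c.shift s) = shiftInput (c.devU s)
      (c.K ⬝ᵥ c.traj (c.devX s) (c.devU s) (pbar + 1)) := by
  funext p
  simp only [devU, shift, shiftInput]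
  split_ifs with h
  · rfl
  · rw [K_predict_last c ho]
    simp

/-! ### The tracking cost -/

lemma trackingCost_parallelogram (x y : State o) (w v : Fin (pbar + 1) → ℝ) :
    c.trackingCost (x + y) (w + v) + c.trackingCost (x - y) (w - v)
      = 2 * c.trackingCost x w + 2 * c.trackingCost y v := by
  have h := quad_parallelogram c.P (c.traj x w (pbar + 1)) (c.traj y v (pbar + 1))
  have hs : ∑ p : Fin (pbar + 1), (c.Q p * (c.Cp p ⬝ᵥ (x + y) + c.Dp p ⬝ᵥ (w + v)) ^ 2
        + c.R p * (w + v) p ^ 2)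
      + ∑ p : Fin (pbar + 1), (c.Q p * (c.Cp p ⬝ᵥ (x - y) + c.Dp p ⬝ᵥ (w - v)) ^ 2
        + c.R p * (w - v) p ^ 2)
      = 2 * ∑ p : Fin (pbar + 1), (c.Q p * (c.Cp p ⬝ᵥ x + c.Dp p ⬝ᵥ w) ^ 2 + c.R p * w p ^ 2)
      + 2 * ∑ p : Fin (pbar + 1), (c.Q p * (c.Cp p ⬝ᵥ y + c.Dp p ⬝ᵥ v) ^ 2 + c.R p * v p ^ 2) := by
    rw [Finset.mul_sum, Finset.mul_sum, ← Finset.sum_add_distrib, ← Finset.sum_add_distrib]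
    refine Finset.sum_congr rfl fun p _ => ?_
    simp only [dotProduct_add, dotProduct_sub, Pi.add_apply, Pi.sub_apply]
    ring
  simp only [trackingCost, traj_add, traj_sub]
  linarith

lemma trackingCost_smul (t : ℝ) (x : State o) (w : Fin (pbar + 1) → ℝ) :
    c.trackingCost (t • x) (t • w) = t ^ 2 * c.trackingCost x w := by
  simp only [trackingCost, traj_smul, smul_quad, mul_add, Finset.mul_sum, dotProduct_smul,
    smul_eq_mul, Pi.smul_apply]
  congr 1
  refine Finset.sum_congr rfl fun p _ => ?_
  ring

variable {c}

namespace WeightsValid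

lemma Q_pos' (h : c.WeightsValid) (p : Fin (pbar + 1)) : 0 < c.Q p :=
  posDef_diagonal_iff.1 h.Q_pos p

/-- The entries of `calR` are `R₀ / 2` and the increments of `R`; positivity accumulates along the
horizon. -/
lemma R_pos' (h : c.WeightsValid) {p : ℕ} (hp : p ≤ pbar) : 0 < c.R p := by
  have hR : ∀ p : Fin (pbar + 1), _ := posDef_diagonal_iff.1 h.R_pos
  induction p with
  | zero =>
    have := hR 0
    simp only [Fin.val_zero, if_true] at this
    linarith
  | succ p ih =>
    have h1 := hR ⟨p + 1, by omega⟩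
    have h2 := ih (by omega)
    simp only [Nat.succ_ne_zero, if_false, Nat.add_sub_cancel] at h1
    linarith

lemma P_nonneg (h : c.WeightsValid) (x : State o) : 0 ≤ x ⬝ᵥ (c.P *ᵥ x) :=
  PosSemidef.quad_nonneg h.P_pos.posSemidef x

lemma trackingCost_nonneg (h : c.WeightsValid) (x : State o) (w : Fin (pbar + 1) → ℝ) :
    0 ≤ c.trackingCost x w :=
  add_nonneg (Finset.sum_nonneg fun p _ => add_nonneg
    (mul_nonneg (h.Q_pos' p).le (sq_nonneg _))
    (mul_nonneg (h.R_pos' (Nat.lt_succ_iff.1 p.2)).le (sq_nonneg _))) (h.P_nonneg _)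

lemma trackingCost_sub_le (h : c.WeightsValid) (x y : State o) (w v : Fin (pbar + 1) → ℝ) :
    c.trackingCost (x - y) (w - v) ≤ 2 * c.trackingCost x w + 2 * c.trackingCost y v := by
  have := c.trackingCost_parallelogram x y w v
  have := h.trackingCost_nonneg (x + y) (w + v)
  linarith

lemma term_le_trackingCost (h : c.WeightsValid) (x : State o) (w : Fin (pbar + 1) → ℝ)
    (p : Fin (pbar + 1)) :
    c.Q p * (c.Cp p ⬝ᵥ x + c.Dp p ⬝ᵥ w) ^ 2 + c.R p * w p ^ 2 ≤ c.trackingCost x w := by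
  have h1 := Finset.single_le_sum (f := fun p : Fin (pbar + 1) =>
      c.Q p * (c.Cp p ⬝ᵥ x + c.Dp p ⬝ᵥ w) ^ 2 + c.R p * w p ^ 2)
    (fun p _ => add_nonneg (mul_nonneg (h.Q_pos' p).le (sq_nonneg _))
      (mul_nonneg (h.R_pos' (Nat.lt_succ_iff.1 p.2)).le (sq_nonneg _))) (Finset.mem_univ p)
  exact h1.trans (le_add_of_nonneg_right (h.P_nonneg _))

lemma terminal_le_trackingCost (h : c.WeightsValid) (x : State o) (w : Fin (pbar + 1) → ℝ) :
    c.traj x w (pbar + 1) ⬝ᵥ (c.P *ᵥ c.traj x w (pbar + 1)) ≤ c.trackingCost x w :=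
  le_add_of_nonneg_left (Finset.sum_nonneg fun p _ => add_nonneg
    (mul_nonneg (h.Q_pos' p).le (sq_nonneg _))
    (mul_nonneg (h.R_pos' (Nat.lt_succ_iff.1 p.2)).le (sq_nonneg _)))

lemma lyapunov_quad (h : c.WeightsValid) (x : State o) :
    (c.AK *ᵥ x) ⬝ᵥ (c.P *ᵥ (c.AK *ᵥ x))
      = x ⬝ᵥ (c.P *ᵥ x) - x ⬝ᵥ (c.TN *ᵥ x) - c.R pbar * (c.K ⬝ᵥ x) ^ 2 := by
  have h1 := congrArg (fun M => x ⬝ᵥ (M *ᵥ x)) h.lyapunov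
  simp only [sub_mulVec, dotProduct_sub, quad_transpose_mul_mul, neg_mulVec, smul_mulVec,
    vecMulVec_mulVec, op_smul_eq_smul, dotProduct_neg, dotProduct_smul, smul_eq_mul] at h1
  rw [dotProduct_comm x c.K] at h1
  linear_combination h1

/-- The appended input `a` does not matter: for `p ≤ pbar` the row `D_p` has a zero in its last
entry. -/
lemma Dp_shiftInput (p : Fin (pbar + 1)) (w : Fin (pbar + 1) → ℝ) (a : ℝ) :
    c.Dp p ⬝ᵥ shiftInput w a = (c.Dp p ᵥ* H₁ pbar) ⬝ᵥ w := by
  rw [← dotProduct_mulVec]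
  refine Finset.sum_congr rfl fun j _ => ?_
  by_cases hj : (j : ℕ) < p
  · congr 1
    have hlt : (j : ℕ) + 1 < pbar + 1 := by omega
    simp only [shiftInput, dif_pos hlt, mulVec, dotProduct, H₁, of_apply]
    rw [Finset.sum_eq_single ⟨j + 1, hlt⟩]
    · simp
    · intro b _ hb
      rw [if_neg, zero_mul]
      exact fun h => hb (Fin.ext h)
    · simp
  · simp [Dp, hj]

/-- The matrix inequality on the weights, evaluated at `(x, w)`: `Ψ` yields the outputs after a
shift, and `Ψ̄` the present outputs, the terminal state and the inputs. -/
lemma output_ineq (h : c.WeightsValid) (x : State o) (w : Fin (pbar + 1) → ℝ) (a : ℝ) :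
    ∑ p : Fin (pbar + 1), c.Q p * (c.Cp p ⬝ᵥ c.traj x w 1 + c.Dp p ⬝ᵥ shiftInput w a) ^ 2
      ≤ ∑ p : Fin pbar,
          c.Q ((p : ℕ) + 1) * (c.Cp ((p : ℕ) + 1) ⬝ᵥ x + c.Dp ((p : ℕ) + 1) ⬝ᵥ w) ^ 2
        + c.traj x w (pbar + 1) ⬝ᵥ (c.TN *ᵥ c.traj x w (pbar + 1))
        + ∑ p : Fin (pbar + 1),
          (if (p : ℕ) = 0 then c.R 0 / 2 else c.R p - c.R ((p : ℕ) - 1)) * w p ^ 2 := by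
  have h1 := PosSemidef.quad_nonneg h.ineq (Sum.elim x w)
  rw [sub_mulVec, dotProduct_sub, quad_transpose_mul_mul, quad_transpose_mul_mul, calQ,
    quad_diagonal] at h1
  have hPsi : ∀ p, (c.Psi *ᵥ Sum.elim x w) p
      = c.Cp p ⬝ᵥ c.traj x w 1 + c.Dp p ⬝ᵥ shiftInput w a := by
    intro p
    rw [mulVec]
    simp only [Psi, of_apply]
    rw [show (fun j => Sum.elim (c.Cp p ᵥ* c.A) (c.Cp p ᵥ* c.B + c.Dp p ᵥ* H₁ pbar) j)
        = Sum.elim (c.Cp p ᵥ* c.A) (c.Cp p ᵥ* c.B + c.Dp p ᵥ* H₁ pbar) from rfl,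
      sumElim_dotProduct_sumElim, add_dotProduct, Dp_shiftInput, traj_one, dotProduct_add,
      ← dotProduct_mulVec, ← dotProduct_mulVec, ← add_assoc]
    congr 3
    funext i
    simp only [mulVec, dotProduct, B, of_apply, Pi.smul_apply, smul_eq_mul]
    rw [Finset.sum_eq_single 0]
    · simp [mul_comm]
    · intro b _ hb
      rw [if_neg, zero_mul]
      exact fun h => hb (Fin.ext h)
    · simp
  have hPsiBar : c.PsiBar *ᵥ Sum.elim x w
      = Sum.elim (fun p : Fin pbar => c.Cp ((p : ℕ) + 1) ⬝ᵥ x + c.Dp ((p : ℕ) + 1) ⬝ᵥ w)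
          (Sum.elim (c.traj x w (pbar + 1)) w) := by
    rw [PsiBar, fromRows_mulVec, fromRows_mulVec, fromCols_mulVec_sumElim,
      fromCols_mulVec_sumElim, traj_last]
    simp only [zero_mulVec, one_mulVec, zero_add]
    congr 1
    funext p
    exact sumElim_dotProduct_sumElim _ _ _ _
  simp only [hPsi] at h1
  rw [hPsiBar, calQbar, fromBlocks_mulVec, fromBlocks_mulVec, sumElim_dotProduct_sumElim] at h1
  simp only [Sum.elim_comp_inl, Sum.elim_comp_inr, zero_mulVec, add_zero, zero_add,
    sumElim_dotProduct_sumElim, quad_diagonal, calR] at h1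
  linarith

/-- Along the shifted candidate, the tracking cost decreases by the cost of the first stage. -/
lemma trackingCost_shift_le (h : c.WeightsValid) (x : State o) (w : Fin (pbar + 1) → ℝ) :
    c.trackingCost (c.traj x w 1) (shiftInput w (c.K ⬝ᵥ c.traj x w (pbar + 1)))
      ≤ c.trackingCost x w - c.Q 0 * (vecC o ⬝ᵥ x) ^ 2 - c.R 0 / 2 * w 0 ^ 2 := by
  set a := c.K ⬝ᵥ c.traj x w (pbar + 1) with ha
  have h1 := h.output_ineq x w a
  have h2 := h.lyapunov_quad (c.traj x w (pbar + 1))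
  have h3 : ∑ p : Fin (pbar + 1), c.R p * shiftInput w a p ^ 2
      = ∑ p : Fin pbar, c.R p * w p.succ ^ 2 + c.R pbar * a ^ 2 := by
    rw [Fin.sum_univ_castSucc]
    congr 1
    · refine Finset.sum_congr rfl fun p _ => ?_
      simp [shiftInput]
      exact Or.inl rfl
    · simp [shiftInput]
  -- The increments in `calR` are what the input penalty gains by the shift. In the final balance
  -- `T_N` and `R_pbar a²` cancel against the Lyapunov equation, and half of `R₀ w₀²` is left over.
  have h4 : ∑ p : Fin (pbar + 1),
        (if (p : ℕ) = 0 then c.R 0 / 2 else c.R p - c.R ((p : ℕ) - 1)) * w p ^ 2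
      = c.R 0 / 2 * w 0 ^ 2 + (∑ p : Fin pbar, c.R ((p : ℕ) + 1) * w p.succ ^ 2
        - ∑ p : Fin pbar, c.R p * w p.succ ^ 2) := by
    rw [Fin.sum_univ_succ, ← Finset.sum_sub_distrib]
    congr 1
    refine Finset.sum_congr rfl fun p _ => ?_
    simp
    ring
  have h5 : ∑ p : Fin (pbar + 1), c.R p * w p ^ 2
      = c.R 0 * w 0 ^ 2 + ∑ p : Fin pbar, c.R ((p : ℕ) + 1) * w p.succ ^ 2 := by
    rw [Fin.sum_univ_succ]; rfl
  have h6 : ∑ p : Fin (pbar + 1), c.Q p * (c.Cp p ⬝ᵥ x + c.Dp p ⬝ᵥ w) ^ 2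
      = c.Q 0 * (vecC o ⬝ᵥ x) ^ 2 + ∑ p : Fin pbar,
        c.Q ((p : ℕ) + 1) * (c.Cp ((p : ℕ) + 1) ⬝ᵥ x + c.Dp ((p : ℕ) + 1) ⬝ᵥ w) ^ 2 := by
    have hD : c.Dp 0 ⬝ᵥ w = 0 := by simp [Dp, dotProduct]
    rw [Fin.sum_univ_succ]
    simp [Cp, hD]
  simp only [trackingCost, Finset.sum_add_distrib, h3, h5, h6]
  rw [ha, traj_shift_last, ← ha, h2]
  linarith

end WeightsValid

end Controller

end LearnedMPC

namespace LearnedMPC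

/-! ### Asymptotics -/

lemma tendsto_zero_of_le_mul_add {a b : ℕ → ℝ} {ρ : ℝ} (ha : ∀ k, 0 ≤ a k) (hρ : 0 ≤ ρ)
    (hρ1 : ρ < 1) (h : ∀ k, a (k + 1) ≤ ρ * a k + b k) (hb : Tendsto b atTop (𝓝 0)) :
    Tendsto a atTop (𝓝 0) := by
  rw [Metric.tendsto_atTop]
  intro ε hε
  -- Perturbations below this level keep `ε / 2` an upper fixed level of the recursion.
  have hpos : 0 < (1 - ρ) * (ε / 2) := mul_pos (sub_pos.2 hρ1) (half_pos hε)
  obtain ⟨K, hK⟩ := eventually_atTop.1 (hb.eventually (gt_mem_nhds hpos))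
  have hbound : ∀ j, a (K + j) ≤ ρ ^ j * a K + ε / 2 := by
    intro j
    induction j with
    | zero => simpa using (half_pos hε).le
    | succ j ih =>
      have h1 := h (K + j)
      have h2 := hK (K + j) (by omega)
      have h3 := mul_le_mul_of_nonneg_left ih hρ
      rw [← add_assoc, pow_succ]
      nlinarith
  have ht : Tendsto (fun j => ρ ^ j * a K) atTop (𝓝 0) := by
    simpa using (tendsto_pow_atTop_nhds_zero_of_lt_one hρ hρ1).mul_const (a K)
  obtain ⟨J, hJ⟩ := eventually_atTop.1 (ht.eventually (gt_mem_nhds (half_pos hε)))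
  refine ⟨K + J, fun n hn => ?_⟩
  obtain ⟨j, rfl⟩ := Nat.exists_eq_add_of_le hn
  have h1 := hbound (J + j)
  have h2 := hJ (J + j) (by omega)
  rw [Real.dist_eq, sub_zero, abs_of_nonneg (ha _), add_assoc]
  linarith

lemma tendsto_zero_of_mul_sq_le {α : Type*} {l : Filter α} {f g : α → ℝ} {q : ℝ} (hq : 0 < q)
    (h : ∀ᶠ k in l, q * f k ^ 2 ≤ g k) (hg : Tendsto g l (𝓝 0)) : Tendsto f l (𝓝 0) := by
  have h1 : Tendsto (fun k => q * f k ^ 2) l (𝓝 0) :=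
    squeeze_zero' (.of_forall fun k => mul_nonneg hq.le (sq_nonneg _)) h hg
  have h2 : Tendsto (fun k => f k ^ 2) l (𝓝 0) := by
    have := h1.const_mul q⁻¹
    simpa [inv_mul_cancel_left₀ hq.ne'] using this
  have h3 := h2.sqrt
  simp only [Real.sqrt_sq_eq_abs, Real.sqrt_zero] at h3
  exact (tendsto_zero_iff_abs_tendsto_zero f).2 h3

section QuadraticForms

variable {ι : Type*} [Fintype ι] {α : Type*} {l : Filter α} {f : α → ι → ℝ}

lemma tendsto_zero_of_quad {P : Matrix ι ι ℝ} (hP : ∀ x, x ≠ 0 → 0 < x ⬝ᵥ (P *ᵥ x))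
    (h : Tendsto (fun k => f k ⬝ᵥ (P *ᵥ f k)) l (𝓝 0)) : Tendsto f l (𝓝 0) := by
  classical
  obtain ⟨b, hb, hle⟩ := exists_quad_le_mul_quad 1 P hP
  refine tendsto_pi_nhds.2 fun i => ?_
  have h1 := h.const_mul b
  rw [mul_zero] at h1
  refine tendsto_zero_of_mul_sq_le one_pos (.of_forall fun k => ?_) h1
  refine le_trans ?_ (hle (f k))
  rw [one_mulVec, one_mul, pow_two]
  exact Finset.single_le_sum (f := fun i => f k i * f k i) (fun i _ => mul_self_nonneg _)
    (Finset.mem_univ i)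

lemma tendsto_quad_zero (P : Matrix ι ι ℝ) (h : Tendsto f l (𝓝 0)) :
    Tendsto (fun k => f k ⬝ᵥ (P *ᵥ f k)) l (𝓝 0) := by
  have hc : Continuous fun x : ι → ℝ => x ⬝ᵥ (P *ᵥ x) := by fun_prop
  simpa [Function.comp_def] using (hc.tendsto 0).comp h

lemma tendsto_mulVec_zero {κ : Type*} (P : Matrix κ ι ℝ) (h : Tendsto f l (𝓝 0)) :
    Tendsto (fun k => P *ᵥ f k) l (𝓝 0) := by
  have hc : Continuous fun x : ι → ℝ => P *ᵥ x := by fun_prop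
  simpa [Function.comp_def] using (hc.tendsto 0).comp h

lemma tendsto_dotProduct_zero (a : ι → ℝ) (h : Tendsto f l (𝓝 0)) :
    Tendsto (fun k => a ⬝ᵥ f k) l (𝓝 0) := by
  have hc : Continuous fun x : ι → ℝ => a ⬝ᵥ x := by fun_prop
  simpa [Function.comp_def] using (hc.tendsto 0).comp h

/-- Young's inequality for a positive semidefinite quadratic form. -/
lemma quad_add_le {P : Matrix ι ι ℝ} (hP : ∀ x, 0 ≤ x ⬝ᵥ (P *ᵥ x)) {t : ℝ} (ht : 0 < t)
    (x y : ι → ℝ) : (x + y) ⬝ᵥ (P *ᵥ (x + y))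
      ≤ (1 + t) * (x ⬝ᵥ (P *ᵥ x)) + (1 + t⁻¹) * (y ⬝ᵥ (P *ᵥ y)) := by
  -- Expanding `t⁻¹ q(t x - y) ≥ 0` bounds the cross terms; no symmetry of `P` is required.
  have h := mul_nonneg (inv_pos.2 ht).le (hP (t • x - y))
  simp only [mulVec_add, mulVec_sub, dotProduct_add, dotProduct_sub, add_dotProduct,
    sub_dotProduct, mulVec_smul, smul_dotProduct, dotProduct_smul, smul_eq_mul] at h ⊢
  have hti : t⁻¹ * t = 1 := inv_mul_cancel₀ ht.ne'
  have h2 : t⁻¹ * (t * (t * (x ⬝ᵥ (P *ᵥ x))) - t * (y ⬝ᵥ (P *ᵥ x))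
        - (t * (x ⬝ᵥ (P *ᵥ y)) - y ⬝ᵥ (P *ᵥ y)))
      = t * (x ⬝ᵥ (P *ᵥ x)) - y ⬝ᵥ (P *ᵥ x) - x ⬝ᵥ (P *ᵥ y) + t⁻¹ * (y ⬝ᵥ (P *ᵥ y)) := by
    linear_combination (t * (x ⬝ᵥ (P *ᵥ x)) - y ⬝ᵥ (P *ᵥ x) - x ⬝ᵥ (P *ᵥ y)) * hti
  have h3 : 0 ≤ t * (x ⬝ᵥ (P *ᵥ x)) - y ⬝ᵥ (P *ᵥ x) - x ⬝ᵥ (P *ᵥ y)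
      + t⁻¹ * (y ⬝ᵥ (P *ᵥ y)) := by
    rw [← h2]; linarith
  linarith

end QuadraticForms

/-! ### Contraction of the auxiliary loop and vanishing deviations -/

namespace Controller.WeightsValid

variable {o pbar : ℕ} {c : Controller o pbar}

/-- The auxiliary closed loop contracts the terminal cost. -/
lemma exists_contraction (h : c.WeightsValid) :
    ∃ b : ℝ, 1 ≤ b ∧ ∀ x : State o,
      (c.AK *ᵥ x) ⬝ᵥ (c.P *ᵥ (c.AK *ᵥ x)) ≤ (1 - b⁻¹) * (x ⬝ᵥ (c.P *ᵥ x)) := by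
  obtain ⟨b, hb, hle⟩ := exists_quad_le_mul_quad c.P c.TN (PosDef.quad_pos h.TN_pos)
  -- Adding `1` makes the constant at least `1`, so that the contraction factor is nonnegative.
  refine ⟨b + 1, by linarith, fun x => ?_⟩
  have hTN : 0 ≤ x ⬝ᵥ (c.TN *ᵥ x) := PosSemidef.quad_nonneg h.TN_pos.posSemidef x
  have h1 : x ⬝ᵥ (c.P *ᵥ x) ≤ (b + 1) * (x ⬝ᵥ (c.TN *ᵥ x)) := (hle x).trans (by linarith)
  have h2 : (b + 1)⁻¹ * (x ⬝ᵥ (c.P *ᵥ x)) ≤ x ⬝ᵥ (c.TN *ᵥ x) :=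
    (inv_mul_le_iff₀ (by linarith)).2 h1
  have h3 := h.lyapunov_quad x
  have h4 := mul_nonneg (h.R_pos' le_rfl).le (sq_nonneg (c.K ⬝ᵥ x))
  linarith

/-- The auxiliary closed loop is robust to vanishing perturbations. -/
lemma tendsto_zero_of_perturbed (h : c.WeightsValid) {T δ : ℕ → State o}
    (hT : ∀ k, T (k + 1) = c.AK *ᵥ T k + δ k) (hδ : Tendsto δ atTop (𝓝 0)) :
    Tendsto T atTop (𝓝 0) := by
  obtain ⟨b, hb, hle⟩ := h.exists_contraction
  have hb0 : 0 < b := by linarith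
  have hi0 : 0 < b⁻¹ := inv_pos.2 hb0
  have hi1 : b⁻¹ ≤ 1 := inv_le_one_of_one_le₀ hb
  refine tendsto_zero_of_quad (PosDef.quad_pos h.P_pos) ?_
  -- Young's inequality with `t = b⁻¹` gives the rate `(1 + b⁻¹)(1 - b⁻¹) = 1 - b⁻² < 1`.
  refine tendsto_zero_of_le_mul_add (ρ := (1 + b⁻¹) * (1 - b⁻¹))
    (b := fun k => (1 + b⁻¹⁻¹) * (δ k ⬝ᵥ (c.P *ᵥ δ k))) (fun k => h.P_nonneg _) ?_ ?_ ?_ ?_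
  · exact mul_nonneg (by linarith) (by linarith)
  · nlinarith
  · intro k
    rw [hT k]
    refine (quad_add_le h.P_nonneg hi0 _ _).trans ?_
    rw [mul_assoc]
    have := mul_le_mul_of_nonneg_left (hle (T k)) (show 0 ≤ 1 + b⁻¹ by linarith)
    linarith
  · simpa using (tendsto_quad_zero c.P hδ).const_mul (1 + b⁻¹⁻¹)

lemma tendsto_AK_pow (h : c.WeightsValid) (x : State o) :
    Tendsto (fun k : ℕ => c.AK ^ k *ᵥ x) atTop (𝓝 0) :=
  h.tendsto_zero_of_perturbed (δ := fun _ => 0)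
    (fun k => by rw [pow_succ', ← mulVec_mulVec, add_zero]) tendsto_const_nhds

/-- Bounds the whole auxiliary orbit by its initial terminal cost, so that the infinitely many
terminal constraints can be checked at once. -/
lemma quad_AK_pow_le (h : c.WeightsValid) (x : State o) (k : ℕ) :
    (c.AK ^ k *ᵥ x) ⬝ᵥ (c.P *ᵥ (c.AK ^ k *ᵥ x)) ≤ x ⬝ᵥ (c.P *ᵥ x) := by
  induction k with
  | zero => simp
  | succ k ih =>
    rw [pow_succ', ← mulVec_mulVec]
    have h1 := h.lyapunov_quad (c.AK ^ k *ᵥ x)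
    have h2 := mul_nonneg (h.R_pos' le_rfl).le (sq_nonneg (c.K ⬝ᵥ (c.AK ^ k *ᵥ x)))
    have h3 : 0 ≤ (c.AK ^ k *ᵥ x) ⬝ᵥ (c.TN *ᵥ (c.AK ^ k *ᵥ x)) :=
      PosSemidef.quad_nonneg h.TN_pos.posSemidef _
    linarith

/-- For state deviations without input deviations, vanishing predicted outputs and terminal states
propagate along `A`. -/
lemma tendsto_outputs_step (h : c.WeightsValid) {f : ℕ → State o}
    (hC : ∀ p ≤ pbar, Tendsto (fun k => c.Cp p ⬝ᵥ f k) atTop (𝓝 0))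
    (hA : Tendsto (fun k => c.A ^ (pbar + 1) *ᵥ f k) atTop (𝓝 0)) :
    ∀ p ≤ pbar, Tendsto (fun k => c.Cp p ⬝ᵥ (c.A *ᵥ f k)) atTop (𝓝 0) := by
  have h1 : Tendsto (fun k => ∑ p : Fin pbar, c.Q ((p : ℕ) + 1) * (c.Cp ((p : ℕ) + 1) ⬝ᵥ f k) ^ 2
      + (c.A ^ (pbar + 1) *ᵥ f k) ⬝ᵥ (c.TN *ᵥ (c.A ^ (pbar + 1) *ᵥ f k))) atTop (𝓝 0) := by
    rw [← add_zero (0 : ℝ)]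
    refine Tendsto.add ?_ (tendsto_quad_zero _ hA)
    rw [← Finset.sum_const_zero (s := (Finset.univ : Finset (Fin pbar)))]
    refine tendsto_finsetSum _ fun p _ => ?_
    simpa using ((hC (p + 1) (by omega)).pow 2).const_mul (c.Q ((p : ℕ) + 1))
  intro p hp
  refine tendsto_zero_of_mul_sq_le (h.Q_pos' ⟨p, by omega⟩) (.of_forall fun k => ?_) h1
  have h2 := h.output_ineq (f k) 0 0
  have h0 : shiftInput (0 : Fin (pbar + 1) → ℝ) 0 = 0 := by
    funext j; simp [shiftInput]
  simp only [h0, traj_one, traj_last, dotProduct_zero, mulVec_zero, add_zero, Pi.zero_apply,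
    zero_smul, ne_eq, OfNat.ofNat_ne_zero, not_false_eq_true, zero_pow, mul_zero,
    Finset.sum_const_zero] at h2
  refine le_trans ?_ h2
  exact Finset.single_le_sum
    (f := fun p : Fin (pbar + 1) => c.Q p * (c.Cp p ⬝ᵥ (c.A *ᵥ f k)) ^ 2)
    (fun p _ => mul_nonneg (h.Q_pos' p).le (sq_nonneg _)) (Finset.mem_univ (⟨p, by omega⟩ : Fin (pbar + 1)))

section Sequence

variable {x : ℕ → State o} {w : ℕ → Fin (pbar + 1) → ℝ}

/-- If a sequence of deviations asymptotically follows the shifted candidates, and its first inputs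
vanish, then all inputs, the terminal states, and all predicted outputs vanish. -/
lemma tendsto_of_asymptotic_shift (h : c.WeightsValid) (h0 : Tendsto (fun k => w k 0) atTop (𝓝 0))
    (hΔ : Tendsto (fun k => c.trackingCost (x (k + 1) - c.traj (x k) (w k) 1)
      (w (k + 1) - shiftInput (w k) (c.K ⬝ᵥ c.traj (x k) (w k) (pbar + 1)))) atTop (𝓝 0)) :
    Tendsto w atTop (𝓝 0) ∧
    Tendsto (fun k => c.traj (x k) (w k) (pbar + 1)) atTop (𝓝 0) ∧
    ∀ p ≤ pbar, ∀ j, Tendsto (fun k => c.Cp p ⬝ᵥ (c.A ^ j *ᵥ x k)) atTop (𝓝 0) := by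
  set Δ : ℕ → State o := fun k => x (k + 1) - c.traj (x k) (w k) 1 with hΔdef
  set ω : ℕ → Fin (pbar + 1) → ℝ := fun k =>
    w (k + 1) - shiftInput (w k) (c.K ⬝ᵥ c.traj (x k) (w k) (pbar + 1)) with hωdef
  have hω : Tendsto ω atTop (𝓝 0) := by
    refine tendsto_pi_nhds.2 fun p => ?_
    refine tendsto_zero_of_mul_sq_le (h.R_pos' (Nat.lt_succ_iff.1 p.2)) (.of_forall fun k => ?_) hΔ
    exact (le_add_of_nonneg_left (mul_nonneg (h.Q_pos' p).le (sq_nonneg _))).trans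
      (h.term_le_trackingCost (Δ k) (ω k) p)
  have hT : Tendsto (fun k => c.traj (Δ k) (ω k) (pbar + 1)) atTop (𝓝 0) :=
    tendsto_zero_of_quad (PosDef.quad_pos h.P_pos)
      (squeeze_zero (fun k => h.P_nonneg _) (fun k => h.terminal_le_trackingCost _ _) hΔ)
  have hCΔ : ∀ p ≤ pbar, Tendsto (fun k => c.Cp p ⬝ᵥ Δ k) atTop (𝓝 0) := by
    intro p hp
    have h1 : Tendsto (fun k => c.Cp p ⬝ᵥ Δ k + c.Dp p ⬝ᵥ ω k) atTop (𝓝 0) := by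
      refine tendsto_zero_of_mul_sq_le (h.Q_pos' ⟨p, by omega⟩) (.of_forall fun k => ?_) hΔ
      exact (le_add_of_nonneg_right (mul_nonneg (h.R_pos' hp).le (sq_nonneg _))).trans
        (h.term_le_trackingCost (Δ k) (ω k) ⟨p, by omega⟩)
    simpa using h1.sub (tendsto_dotProduct_zero (c.Dp p) hω)
  have hAΔ : Tendsto (fun k => c.A ^ (pbar + 1) *ᵥ Δ k) atTop (𝓝 0) := by
    have := hT.sub (tendsto_mulVec_zero c.Γ hω)
    simpa [traj_last] using this
  -- The pair of properties propagates from `A ^ j Δ` to `A ^ (j + 1) Δ` by the matrix inequality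
  -- with zero inputs.
  have hCAΔ : ∀ j, (∀ p ≤ pbar, Tendsto (fun k => c.Cp p ⬝ᵥ (c.A ^ j *ᵥ Δ k)) atTop (𝓝 0)) ∧
      Tendsto (fun k => c.A ^ (pbar + 1) *ᵥ (c.A ^ j *ᵥ Δ k)) atTop (𝓝 0) := by
    intro j
    induction j with
    | zero => simpa using ⟨hCΔ, hAΔ⟩
    | succ j ih =>
      refine ⟨?_, ?_⟩
      · simpa only [mulVec_mulVec, ← pow_succ'] using h.tendsto_outputs_step ih.1 ih.2
      · have := tendsto_mulVec_zero c.A ih.2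
        simp only [mulVec_mulVec, ← pow_succ', ← pow_add] at this ⊢
        exact this
  have hw : ∀ (p : ℕ) (hp : p < pbar + 1), Tendsto (fun k => w k ⟨p, hp⟩) atTop (𝓝 0) := by
    intro p
    induction p with
    | zero => exact fun _ => h0
    | succ p ih =>
      intro hp
      -- Input `p + 1` at time `k` is input `p` at time `k + 1`, up to the mismatch `ω`.
      have h1 := ((ih (by omega)).comp (tendsto_add_atTop_nat 1)).sub
        (tendsto_pi_nhds.1 hω ⟨p, by omega⟩)
      refine (h1.congr fun k => ?_).trans (by simp)
      simp [hωdef, shiftInput, Nat.lt_of_succ_lt_succ hp]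
  have hw' : Tendsto w atTop (𝓝 0) := tendsto_pi_nhds.2 fun p => hw p p.2
  have hTx : Tendsto (fun k => c.traj (x k) (w k) (pbar + 1)) atTop (𝓝 0) := by
    -- The terminal states follow the auxiliary loop, perturbed by the terminal state of the
    -- mismatch.
    refine h.tendsto_zero_of_perturbed (fun k => ?_) hT
    rw [← traj_shift_last, ← traj_add]
    simp [hΔdef, hωdef]
  refine ⟨hw', hTx, ?_⟩
  have hAx : Tendsto (fun k => c.A ^ (pbar + 1) *ᵥ x k) atTop (𝓝 0) := by
    have := hTx.sub (tendsto_mulVec_zero c.Γ hw')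
    simpa [traj_last] using this
  have hstep : ∀ p ≤ pbar, ∀ j,
      Tendsto (fun k => c.Cp p ⬝ᵥ (c.A ^ (j + 1) *ᵥ x k)) atTop (𝓝 0) →
      Tendsto (fun k => c.Cp p ⬝ᵥ (c.A ^ j *ᵥ x k)) atTop (𝓝 0) := by
    intro p hp j hj
    -- One time step trades a power of `A`: `A ^ j x(k+1)` is `A ^ (j+1) x(k)` plus vanishing input
    -- and mismatch terms.
    rw [← tendsto_add_atTop_iff_nat 1]
    have h1 := (hj.add (h0.mul_const (c.Cp p ⬝ᵥ (c.A ^ j *ᵥ c.B₁)))).add ((hCAΔ j).1 p hp)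
    simp only [zero_mul, add_zero] at h1
    refine h1.congr fun k => ?_
    have hx : x (k + 1) = c.A *ᵥ x k + w k 0 • c.B₁ + Δ k := by
      simp [hΔdef, traj_one]
    rw [hx]
    simp only [mulVec_add, mulVec_smul, dotProduct_add, dotProduct_smul, mulVec_mulVec,
      ← pow_succ, smul_eq_mul]
  intro p hp j
  -- High powers factor through the vanishing vector `A ^ (pbar + 1) x`; lower ones follow by
  -- descent.
  rcases le_total (pbar + 1) j with hj | hj
  · obtain ⟨l, rfl⟩ := Nat.exists_eq_add_of_le' hj
    have := tendsto_dotProduct_zero (c.Cp p) (tendsto_mulVec_zero (c.A ^ l) hAx)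
    simpa only [mulVec_mulVec, ← pow_add] using this
  · induction hj using Nat.decreasingInduction with
    | self => exact tendsto_dotProduct_zero (c.Cp p) hAx
    | of_succ j hj ih => exact hstep p hp j ih

end Sequence

end Controller.WeightsValid

end LearnedMPC

namespace LearnedMPC

namespace Controller

variable {o pbar : ℕ} (c : Controller o pbar)

/-! ### The terminal set and the admissible set-points -/

lemma vecC_Nvec (ho : 0 < o) : vecC o ⬝ᵥ c.Nvec = 1 := by
  rw [vecC_dotProduct ho]; rfl

lemma mem_setPoints (ho : 0 < o) {z : ℝ} :
    z ∈ c.setPoints ↔ (z, c.μ⁻¹ * z, c.η * z) ∈ c.Xε := by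
  rw [setPoints, Set.mem_ofPred_eq, dotProduct_smul, vecC_Nvec c ho, smul_eq_mul, mul_one]

lemma auxStep_iterate (ho : 0 < o) (x : State o) (r : ℝ) (k : ℕ) :
    c.auxStep^[k] (x, r) = (r • c.Nvec + c.AK ^ k *ᵥ (x - r • c.Nvec), r) := by
  induction k with
  | zero => simp
  | succ k ih =>
    rw [Function.iterate_succ_apply', ih, auxStep]
    ext1
    · simp only
      have h1 : (c.M₂ * r) • c.B₁ = (r * c.μ⁻¹) • c.B₁ - (r * (c.K ⬝ᵥ c.Nvec)) • c.B₁ := by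
        rw [← sub_smul, M₂]; congr 1; ring
      have h2 := congrArg (r • ·) (c.steady_state ho)
      simp only [smul_add, smul_smul] at h2
      rw [mulVec_add, mulVec_mulVec, ← pow_succ', AK_mulVec c (r • c.Nvec), mulVec_smul,
        dotProduct_smul, h1, smul_eq_mul, mul_comm c.η, ← h2]
      abel
    · rfl

lemma auxOut_iterate (ho : 0 < o) (x : State o) (r : ℝ) (k : ℕ) :
    c.auxOut (c.auxStep^[k] (x, r))
      = (r + vecC o ⬝ᵥ (c.AK ^ k *ᵥ (x - r • c.Nvec)),
        c.μ⁻¹ * r + c.K ⬝ᵥ (c.AK ^ k *ᵥ (x - r • c.Nvec)), c.η * r) := by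
  rw [auxStep_iterate c ho, auxOut]
  simp only [dotProduct_add, dotProduct_smul, vecC_Nvec c ho, smul_eq_mul, mul_one, M₂]
  congr 2
  ring

variable {c}

/-- The terminal set, explicitly. -/
lemma mem_terminalSet_iff (ho : 0 < o) (h : c.WeightsValid) {x : State o} {r : ℝ} :
    (x, r) ∈ c.terminalSet ↔
      (∀ k : ℕ, (r + vecC o ⬝ᵥ (c.AK ^ k *ᵥ (x - r • c.Nvec)),
        c.μ⁻¹ * r + c.K ⬝ᵥ (c.AK ^ k *ᵥ (x - r • c.Nvec)), c.η * r) ∈ c.Xzuw) ∧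
      r ∈ c.setPoints := by
  rw [terminalSet, Set.mem_ofPred_eq]
  simp only [auxOut_iterate c ho, mem_setPoints c ho]
  refine and_congr_right fun _ => ?_
  -- The auxiliary orbit always converges to the steady state of `r`, so the limit condition only
  -- says that this steady state belongs to `Xε`.
  have hlim := h.tendsto_AK_pow (x - r • c.Nvec)
  have ht : Tendsto (fun k : ℕ => (r + vecC o ⬝ᵥ (c.AK ^ k *ᵥ (x - r • c.Nvec)),
      c.μ⁻¹ * r + c.K ⬝ᵥ (c.AK ^ k *ᵥ (x - r • c.Nvec)), c.η * r)) atTop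
      (𝓝 (r, c.μ⁻¹ * r, c.η * r)) := by
    refine Tendsto.prodMk_nhds ?_ (Tendsto.prodMk_nhds ?_ tendsto_const_nhds)
    · simpa using (tendsto_dotProduct_zero (vecC o) hlim).const_add r
    · simpa using (tendsto_dotProduct_zero c.K hlim).const_add (c.μ⁻¹ * r)
  constructor
  · rintro ⟨y, hy, hty⟩
    rwa [← tendsto_nhds_unique hty ht]
  · exact fun hy => ⟨_, hy, ht⟩

lemma convex_W : Convex ℝ c.W := by
  have : c.W = Set.Icc (-c.wbar) c.wbar := by
    ext w; simp [W, abs_le]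
  rw [this]
  exact convex_Icc _ _

lemma convex_Xzuw (hcv : c.ConvexSets) : Convex ℝ c.Xzuw :=
  hcv.Zbar.prod (hcv.Ubar.prod convex_W)

lemma convex_setPoints (ho : 0 < o) (hcv : c.ConvexSets) : Convex ℝ c.setPoints := by
  intro x hx y hy a b ha hb hab
  rw [mem_setPoints c ho] at hx hy ⊢
  convert hcv.Xε hx hy ha hb hab using 1
  simp only [Prod.smul_mk, Prod.mk_add_mk, smul_eq_mul, Prod.mk.injEq, true_and]
  constructor <;> ring

lemma isCompact_setPoints (ho : 0 < o) (hX : IsCompact c.Xε) : IsCompact c.setPoints := by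
  have hcl : IsClosed c.setPoints :=
    hX.isClosed.preimage (f := fun z : ℝ => (vecC o ⬝ᵥ (z • c.Nvec), c.μ⁻¹ * z, c.η * z))
      (by fun_prop)
  refine (hX.image continuous_fst).of_isClosed_subset hcl fun z hz => ?_
  exact ⟨_, (mem_setPoints c ho).1 hz, rfl⟩

lemma exists_isClosest (ho : 0 < o) (hX : IsCompact c.Xε) (hne : c.setPoints.Nonempty)
    (zgoal : ℝ) : ∃ zf, c.IsClosest zgoal zf := by
  obtain ⟨z, hz, hmin⟩ := (isCompact_setPoints ho hX).exists_isMinOn hne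
    (f := fun z => |z - zgoal|) (by fun_prop)
  exact ⟨z, hz, fun y hy => hmin hy⟩

/-- The variational inequality for the closest set-point. -/
lemma IsClosest.mul_nonneg (ho : 0 < o) (hcv : c.ConvexSets) {zgoal zf y : ℝ}
    (hzf : c.IsClosest zgoal zf) (hy : y ∈ c.setPoints) : 0 ≤ (y - zf) * (zf - zgoal) := by
  have key : ∀ t : ℝ, 0 < t → t ≤ 1 →
      0 ≤ 2 * ((y - zf) * (zf - zgoal)) + t * (y - zf) ^ 2 := by
    intro t ht ht1
    have hm := hzf.2 _ (convex_setPoints ho hcv hzf.1 hy (sub_nonneg.2 ht1) ht.le (by ring))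
    have h2 := sq_le_sq.2 hm
    simp only [smul_eq_mul] at h2
    have h3 : 0 ≤ t * (2 * ((y - zf) * (zf - zgoal)) + t * (y - zf) ^ 2) := by linarith
    exact nonneg_of_mul_nonneg_right h3 ht
  have hlim : Tendsto (fun t : ℝ => 2 * ((y - zf) * (zf - zgoal)) + t * (y - zf) ^ 2) (𝓝[>] 0)
      (𝓝 (2 * ((y - zf) * (zf - zgoal)) + 0 * (y - zf) ^ 2)) :=
    Tendsto.mono_left (Continuous.tendsto (by fun_prop) 0) nhdsWithin_le_nhds
  have h0 := ge_of_tendsto hlim (by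
    filter_upwards [Ioc_mem_nhdsGT (zero_lt_one' ℝ)] with t ht using key t ht.1 ht.2)
  linarith

/-- The two variational inequalities add up to `-(y - x)² ≥ 0`. -/
lemma IsClosest.unique (ho : 0 < o) (hcv : c.ConvexSets) {zgoal x y : ℝ}
    (hx : c.IsClosest zgoal x) (hy : c.IsClosest zgoal y) : y = x := by
  have h1 := hx.mul_nonneg ho hcv hy.1
  have h2 := hy.mul_nonneg ho hcv hx.1
  have h3 : (y - x) ^ 2 ≤ 0 := by nlinarith
  exact sub_eq_zero.1 (pow_eq_zero_iff two_ne_zero |>.1 (le_antisymm h3 (sq_nonneg _)))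

/-! ### Averages of decisions -/

/-- The average of two decisions. -/
noncomputable def average (s t : Decision o pbar) : Decision o pbar where
  X := (1 / 2 : ℝ) • s.X + (1 / 2 : ℝ) • t.X
  U := (1 / 2 : ℝ) • s.U + (1 / 2 : ℝ) • t.U
  zref := (1 / 2 : ℝ) • s.zref + (1 / 2 : ℝ) • t.zref

lemma devX_average (s t : Decision o pbar) :
    c.devX (average s t) = (1 / 2 : ℝ) • c.devX s + (1 / 2 : ℝ) • c.devX t := by
  simp only [devX, average, smul_sub, add_smul, smul_assoc]
  abel

lemma devU_average (s t : Decision o pbar) :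
    c.devU (average s t) = (1 / 2 : ℝ) • c.devU s + (1 / 2 : ℝ) • c.devU t := by
  funext p
  simp only [devU, average, Pi.add_apply, Pi.smul_apply, smul_eq_mul]
  ring

lemma predict_average (ho : 0 < o) (s t : Decision o pbar) {j : ℕ} (hj : j ≤ pbar + 1) :
    c.predict (average s t) j = (1 / 2 : ℝ) • c.predict s j + (1 / 2 : ℝ) • c.predict t j := by
  rw [c.predict_eq ho _ hj, c.predict_eq ho _ hj, c.predict_eq ho _ hj, devX_average, devU_average,
    traj_add, traj_smul, traj_smul]
  simp only [average, smul_add, add_smul, smul_assoc]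
  abel

lemma Admissible.average (ho : 0 < o) (h : c.WeightsValid) (hcv : c.ConvexSets) {Xh : State o}
    {s t : Decision o pbar} (hs : c.Admissible Xh s) (ht : c.Admissible Xh t) :
    c.Admissible Xh (average s t) := by
  have h0 : (0 : ℝ) ≤ 1 / 2 := by norm_num
  have h1 : (1 / 2 : ℝ) + 1 / 2 = 1 := by norm_num
  have hW : Convex ℝ c.W := convex_W
  refine ⟨?_, fun p => ?_, fun p => ?_, ?_, ?_⟩
  · convert hcv.Ebar hs.initial ht.initial h0 h0 h1 using 1
    funext i
    simp only [Controller.average, Pi.add_apply, Pi.sub_apply, Pi.smul_apply, smul_eq_mul]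
    ring
  · exact hcv.Ubar (hs.input p) (ht.input p) h0 h0 h1
  · rw [predict_average ho _ _ (by omega), dotProduct_add, dotProduct_smul, dotProduct_smul]
    exact hcv.Zbar (hs.output p) (ht.output p) h0 h0 h1
  · convert hW hs.estimate ht.estimate h0 h0 h1 using 1
    simp only [Controller.average, smul_eq_mul]
    ring
  · have h2 := (mem_terminalSet_iff ho h).1 hs.terminal
    have h3 := (mem_terminalSet_iff ho h).1 ht.terminal
    refine (mem_terminalSet_iff ho h).2 ⟨fun k => ?_, ?_⟩
    · convert convex_Xzuw hcv (h2.1 k) (h3.1 k) h0 h0 h1 using 1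
      have hx : c.predict (Controller.average s t) (pbar + 1)
            - (Controller.average s t).zref • c.Nvec
          = (1 / 2 : ℝ) • (c.predict s (pbar + 1) - s.zref • c.Nvec)
            + (1 / 2 : ℝ) • (c.predict t (pbar + 1) - t.zref • c.Nvec) := by
        rw [predict_average ho _ _ le_rfl]
        simp only [Controller.average, smul_sub, add_smul, smul_assoc]
        abel
      rw [hx]
      simp only [Controller.average, mulVec_add, mulVec_smul, dotProduct_add, dotProduct_smul,
        Prod.smul_mk, Prod.mk_add_mk, smul_eq_mul, Prod.mk.injEq]
      refine ⟨?_, ?_, ?_⟩ <;> ring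
    · exact convex_setPoints ho hcv h2.2 h3.2 h0 h0 h1

/-- Strong convexity of the cost in the outputs: an optimal decision is close to every admissible
decision of almost the same cost. -/
lemma IsOptimal.trackingCost_sub_le (ho : 0 < o) (h : c.WeightsValid) (hcv : c.ConvexSets)
    {σ zgoal : ℝ} (hσ : 0 ≤ σ) {Xh : State o} {s t : Decision o pbar}
    (hs : c.IsOptimal σ zgoal Xh s) (ht : c.Admissible Xh t) :
    c.trackingCost (c.devX s - c.devX t) (c.devU s - c.devU t)
      ≤ 2 * (c.cost σ zgoal t - c.cost σ zgoal s) := by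
  have h1 := hs.2 _ (hs.1.average ho h hcv ht)
  -- The average lies below the mean of the two costs by at least a quarter of the tracking cost of
  -- the difference, yet cannot beat the optimum.
  have h2 := c.trackingCost_parallelogram ((1 / 2 : ℝ) • c.devX s) ((1 / 2 : ℝ) • c.devX t)
    ((1 / 2 : ℝ) • c.devU s) ((1 / 2 : ℝ) • c.devU t)
  rw [← smul_sub, ← smul_sub, trackingCost_smul, trackingCost_smul, trackingCost_smul,
    ← devX_average, ← devU_average] at h2
  rw [cost_eq c ho] at h1 ⊢
  rw [cost_eq c ho] at h1 ⊢
  have h3 : ((average s t).zref - zgoal) ^ 2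
      ≤ (1 / 2) * (s.zref - zgoal) ^ 2 + (1 / 2) * (t.zref - zgoal) ^ 2 := by
    simp only [average, smul_eq_mul]
    nlinarith [sq_nonneg (s.zref - t.zref)]
  have h4 := mul_le_mul_of_nonneg_left h3 hσ
  linarith

/-! ### Moving the reference towards the closest set-point -/

/-- From a decision close to the steady state, the reference may be moved by a small amount, within
the admissible set-points, without violating the constraints. -/
lemma Admissible.move_ref {S : Plant} {Z : Set ℝ} (ho : 0 < o) (hc : c.WellDesigned S Z)
    {Xh : State o} {s : Decision o pbar}
    (hs : c.Admissible Xh s) {r' b : ℝ}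
    (hb : ∀ y : State o, (vecC o ⬝ᵥ y) ^ 2 + (c.K ⬝ᵥ y) ^ 2 ≤ b * (y ⬝ᵥ (c.P *ᵥ y)))
    (hb0 : 0 < b) (hr' : r' ∈ c.setPoints)
    (h1 : ∀ p : Fin (pbar + 1),
      |r' - s.zref| * (1 + |vecC o ⬝ᵥ c.traj c.Nvec (fun _ => c.μ⁻¹) p|) ≤ c.ε / 2)
    (h2 : b * (2 * ((r' - s.zref) ^ 2 * (c.traj c.Nvec (fun _ : Fin (pbar + 1) => c.μ⁻¹) (pbar + 1)
      ⬝ᵥ (c.P *ᵥ c.traj c.Nvec (fun _ : Fin (pbar + 1) => c.μ⁻¹) (pbar + 1))))) ≤ c.ε ^ 2 / 2)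
    (h3 : ∀ p : Fin (pbar + 1), |vecC o ⬝ᵥ c.traj (c.devX s) (c.devU s) p| ≤ c.ε / 2)
    (h4 : b * (2 * (c.traj (c.devX s) (c.devU s) (pbar + 1)
      ⬝ᵥ (c.P *ᵥ c.traj (c.devX s) (c.devU s) (pbar + 1)))) ≤ c.ε ^ 2 / 2) :
    c.Admissible Xh ⟨s.X, s.U, r'⟩ := by
  have hw := hc.weights
  have hmem : ∀ {z : ℝ}, z ∈ c.setPoints → ∀ a b : ℝ, a ^ 2 + b ^ 2 ≤ c.ε ^ 2 →
      (z + a, c.μ⁻¹ * z + b, c.η * z) ∈ c.Xzuw := by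
    intro z hz a b hab
    have := hc.Xε_sub _ ((mem_setPoints c ho).1 hz) a b 0 (by simpa using hab)
    simpa using this
  have hdev : ∀ j, c.traj (c.devX ⟨s.X, s.U, r'⟩) (c.devU ⟨s.X, s.U, r'⟩) j
      = c.traj (c.devX s) (c.devU s) j
        - (r' - s.zref) • c.traj c.Nvec (fun _ : Fin (pbar + 1) => c.μ⁻¹) j := by
    intro j
    rw [← traj_smul, ← traj_sub]
    congr 1
    · simp only [devX, sub_smul]; abel
    · funext p
      simp only [devU, Pi.sub_apply, Pi.smul_apply, smul_eq_mul]
      ring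
  have hzref := ((mem_terminalSet_iff ho hw).1 hs.terminal).2
  refine ⟨hs.initial, hs.input, fun p => ?_, ?_, ?_⟩
  · rw [c.predict_eq ho _ (by omega), hdev, dotProduct_add, dotProduct_smul, vecC_Nvec c ho,
      dotProduct_sub, dotProduct_smul]
    -- The predicted output is the old set-point plus `a`; half of `ε` pays for the move of the
    -- reference, half for the existing deviation.
    set a := r' - s.zref + (vecC o ⬝ᵥ c.traj (c.devX s) (c.devU s) p
      - (r' - s.zref) * (vecC o ⬝ᵥ c.traj c.Nvec (fun _ : Fin (pbar + 1) => c.μ⁻¹) p)) with ha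
    have habs : |a| ≤ c.ε := by
      have e1 := abs_add_le (r' - s.zref) (vecC o ⬝ᵥ c.traj (c.devX s) (c.devU s) p
        - (r' - s.zref) * (vecC o ⬝ᵥ c.traj c.Nvec (fun _ : Fin (pbar + 1) => c.μ⁻¹) p))
      have e2 := abs_sub (vecC o ⬝ᵥ c.traj (c.devX s) (c.devU s) p)
        ((r' - s.zref) * (vecC o ⬝ᵥ c.traj c.Nvec (fun _ : Fin (pbar + 1) => c.μ⁻¹) p))
      rw [abs_mul] at e2
      have e3 := h1 p
      have e4 := h3 p
      rw [mul_add, mul_one] at e3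
      linarith
    have hsq : a ^ 2 + 0 ^ 2 ≤ c.ε ^ 2 := by
      rw [zero_pow two_ne_zero, add_zero]
      exact sq_le_sq' (by linarith [neg_abs_le a]) ((le_abs_self a).trans habs)
    have := (hmem hzref a 0 hsq).1
    simp only at this
    convert this using 1
    simp only [ha, smul_eq_mul, mul_one]
    ring
  · have := (hmem hr' 0 0 (by simpa using sq_nonneg c.ε)).2.2
    exact this
  · refine (mem_terminalSet_iff ho hw).2 ⟨fun k => hmem hr' _ _ ?_, hr'⟩
    -- `b` converts the terminal cost into the size of the output and input deviations, to be kept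
    -- within the `ε`-ball around the new set-point.
    refine (hb _).trans ?_
    rw [c.predict_eq ho _ le_rfl, add_sub_cancel_left, hdev]
    refine (mul_le_mul_of_nonneg_left (hw.quad_AK_pow_le _ k) hb0.le).trans ?_
    have e1 := quad_parallelogram c.P (c.traj (c.devX s) (c.devU s) (pbar + 1))
      ((r' - s.zref) • c.traj c.Nvec (fun _ : Fin (pbar + 1) => c.μ⁻¹) (pbar + 1))
    rw [smul_quad] at e1
    have e2 := hw.P_nonneg (c.traj (c.devX s) (c.devU s) (pbar + 1)
      + (r' - s.zref) • c.traj c.Nvec (fun _ : Fin (pbar + 1) => c.μ⁻¹) (pbar + 1))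
    have e3 : (c.traj (c.devX s) (c.devU s) (pbar + 1)
          - (r' - s.zref) • c.traj c.Nvec (fun _ : Fin (pbar + 1) => c.μ⁻¹) (pbar + 1))
        ⬝ᵥ (c.P *ᵥ (c.traj (c.devX s) (c.devU s) (pbar + 1)
          - (r' - s.zref) • c.traj c.Nvec (fun _ : Fin (pbar + 1) => c.μ⁻¹) (pbar + 1)))
        ≤ _ := (le_add_of_nonneg_left e2).trans e1.le
    refine (mul_le_mul_of_nonneg_left e3 hb0.le).trans ?_
    linarith

/-- Optimality against a reference moved towards the closest set-point bounds the distance of the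
reference from it. -/
lemma IsOptimal.sq_sub_le (ho : 0 < o) (h : c.WeightsValid) (hcv : c.ConvexSets)
    {σ zgoal zf β : ℝ} (hσ : 0 < σ) {Xh : State o} {s : Decision o pbar}
    (hs : c.IsOptimal σ zgoal Xh s) (hzf : c.IsClosest zgoal zf) (hr : s.zref ∈ c.setPoints)
    (hβ : 0 < β) (hβ1 : β ≤ 1)
    (hβM : 2 * β * c.trackingCost c.Nvec (fun _ => c.μ⁻¹) ≤ σ / 2)
    (hadm : c.Admissible Xh ⟨s.X, s.U, s.zref + β * (zf - s.zref)⟩) :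
    σ * β / 2 * (s.zref - zf) ^ 2 ≤ c.trackingCost (c.devX s) (c.devU s) := by
  have h1 := hs.2 _ hadm
  rw [cost_eq c ho, cost_eq c ho] at h1
  have hX : c.devX ⟨s.X, s.U, s.zref + β * (zf - s.zref)⟩
      = c.devX s - (β * (zf - s.zref)) • c.Nvec := by
    simp only [devX, add_smul]; abel
  have hU : c.devU ⟨s.X, s.U, s.zref + β * (zf - s.zref)⟩
      = c.devU s - (β * (zf - s.zref)) • (fun _ : Fin (pbar + 1) => c.μ⁻¹) := by
    funext p
    simp only [devU, Pi.sub_apply, Pi.smul_apply, smul_eq_mul]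
    ring
  have h2 := h.trackingCost_sub_le (c.devX s) ((β * (zf - s.zref)) • c.Nvec) (c.devU s)
    ((β * (zf - s.zref)) • (fun _ : Fin (pbar + 1) => c.μ⁻¹))
  rw [← hX, ← hU, trackingCost_smul] at h2
  simp only at h1
  have h3 := hzf.mul_nonneg ho hcv hr
  set M := c.trackingCost c.Nvec (fun _ : Fin (pbar + 1) => c.μ⁻¹) with hM
  set q := c.trackingCost (c.devX s) (c.devU s)
  have h4 : (s.zref + β * (zf - s.zref) - zgoal) ^ 2
      ≤ (s.zref - zgoal) ^ 2 - β * (s.zref - zf) ^ 2 := by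
    have e1 : (s.zref + β * (zf - s.zref) - zgoal) ^ 2
        = (s.zref - zgoal) ^ 2 - 2 * β * (s.zref - zf) ^ 2 + β ^ 2 * (s.zref - zf) ^ 2
          - 2 * β * ((s.zref - zf) * (zf - zgoal)) := by ring
    have e2 : 0 ≤ β * ((s.zref - zf) * (zf - zgoal)) := _root_.mul_nonneg hβ.le h3
    have e3 : β ^ 2 * (s.zref - zf) ^ 2 ≤ β * (s.zref - zf) ^ 2 :=
      mul_le_mul_of_nonneg_right (by nlinarith) (sq_nonneg _)
    linarith
  have h5 := mul_le_mul_of_nonneg_left h4 hσ.le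
  -- Moving the reference lowers the offset cost by at least `σ β (zref - zf)²`; the tracking
  -- penalty of the move is of order `β²` and, for small `β`, uses at most half of this gain.
  have h6 : 2 * ((β * (zf - s.zref)) ^ 2 * M) ≤ σ * β / 2 * (s.zref - zf) ^ 2 := by
    have e1 := mul_le_mul_of_nonneg_right hβM
      (_root_.mul_nonneg hβ.le (sq_nonneg (s.zref - zf)))
    calc 2 * ((β * (zf - s.zref)) ^ 2 * M) = 2 * β * M * (β * (s.zref - zf) ^ 2) := by ring
      _ ≤ σ / 2 * (β * (s.zref - zf) ^ 2) := e1
      _ = _ := by ring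
  linarith

end Controller

end LearnedMPC

namespace LearnedMPC

namespace IsClosedLoop

open Controller

variable {o pbar : ℕ} {S : Plant} {c : Controller o pbar} {Z : Set ℝ} {σ zgoal : ℝ}
  {r : Signals o pbar}

/-! ### Convergence of the closed loop -/

lemma cost_succ_le (h : IsClosedLoop S c σ zgoal r) (hc : c.WellDesigned S Z) (hpos : 0 < o)
    (hfeas : ∀ k, c.Feasible (r.Xhat k) ∧ r.err k ∈ c.Ehat) (k : ℕ) :
    c.Admissible (r.Xhat (k + 1)) (c.shift (r.sol k)) ∧
    c.cost σ zgoal (c.shift (r.sol k)) ≤ c.cost σ zgoal (r.sol k)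
      - c.Q 0 * (vecC o ⬝ᵥ c.devX (r.sol k)) ^ 2 - c.R 0 / 2 * c.devU (r.sol k) 0 ^ 2 := by
  refine ⟨(h.optimal k (hfeas k).1).1.shift (h.deviation_mem hc hpos (hfeas k).1 (hfeas k).2), ?_⟩
  rw [cost_eq c hpos, cost_eq c hpos, devX_shift c hpos, devU_shift c hpos]
  have h1 := hc.weights.trackingCost_shift_le (c.devX (r.sol k)) (c.devU (r.sol k))
  have h2 : (c.shift (r.sol k)).zref = (r.sol k).zref := rfl
  rw [h2]
  linarith

/-- The deviations from the steady state vanish, as far as the cost sees them. -/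
lemma tendsto_deviations (h : IsClosedLoop S c σ zgoal r) (hc : c.WellDesigned S Z)
    (hcv : c.ConvexSets) (hσ : 0 < σ) (hpos : 0 < o)
    (hfeas : ∀ k, c.Feasible (r.Xhat k) ∧ r.err k ∈ c.Ehat) :
    Tendsto (fun k => c.devU (r.sol k)) atTop (𝓝 0) ∧
    Tendsto (fun k => c.traj (c.devX (r.sol k)) (c.devU (r.sol k)) (pbar + 1)) atTop (𝓝 0) ∧
    ∀ p ≤ pbar, ∀ j, Tendsto (fun k => c.Cp p ⬝ᵥ (c.A ^ j *ᵥ c.devX (r.sol k))) atTop (𝓝 0) := by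
  have hw := hc.weights
  set V : ℕ → ℝ := fun k => c.cost σ zgoal (r.sol k) with hV
  have hV0 : ∀ k, 0 ≤ V k := fun k => by
    simp only [hV, cost_eq c hpos]
    exact add_nonneg (hw.trackingCost_nonneg _ _) (mul_nonneg hσ.le (sq_nonneg _))
  have hQ : 0 < c.Q 0 := by simpa using hw.Q_pos' 0
  have hR : 0 < c.R 0 / 2 := half_pos (hw.R_pos' (Nat.zero_le _))
  have hstep : ∀ k, c.cost σ zgoal (c.shift (r.sol k)) ≤ V k - c.R 0 / 2 * c.devU (r.sol k) 0 ^ 2 :=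
    fun k => (h.cost_succ_le hc hpos hfeas k).2.trans (by
      have := mul_nonneg hQ.le (sq_nonneg (vecC o ⬝ᵥ c.devX (r.sol k)))
      simp only [hV]
      linarith)
  have hopt : ∀ k, V (k + 1) ≤ c.cost σ zgoal (c.shift (r.sol k)) := fun k =>
    (h.optimal (k + 1) (hfeas _).1).2 _ (h.cost_succ_le hc hpos hfeas k).1
  have hnn : ∀ k, 0 ≤ c.R 0 / 2 * c.devU (r.sol k) 0 ^ 2 := fun k =>
    mul_nonneg hR.le (sq_nonneg _)
  have hanti : Antitone V := antitone_nat_of_succ_le fun k => by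
    have := hnn k
    linarith [hstep k, hopt k]
  have hlim : Tendsto V atTop (𝓝 (⨅ k, V k)) :=
    tendsto_atTop_ciInf hanti ⟨0, by rintro _ ⟨k, rfl⟩; exact hV0 k⟩
  have hdiff : Tendsto (fun k => V k - V (k + 1)) atTop (𝓝 0) := by
    simpa using hlim.sub (hlim.comp (tendsto_add_atTop_nat 1))
  refine hw.tendsto_of_asymptotic_shift ?_ ?_
  · refine tendsto_zero_of_mul_sq_le hR (.of_forall fun k => ?_) hdiff
    linarith [hstep k, hopt k]
  -- The candidate costs at most `V k`, so its excess over the next optimum is at most `V k - V (k +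
  -- 1)`.
  · refine squeeze_zero (fun k => hw.trackingCost_nonneg _ _) (fun k => ?_)
      (by simpa using hdiff.const_mul 2)
    rw [← devX_shift c hpos, ← devU_shift c hpos]
    have := (h.optimal (k + 1) (hfeas _).1).trackingCost_sub_le hpos hw hcv hσ.le
      (h.cost_succ_le hc hpos hfeas k).1
    refine this.trans ?_
    have h1 := hstep k
    have h2 := hnn k
    simp only [hV] at h1 ⊢
    linarith

lemma tendsto_trackingCost (hw : Tendsto (fun k => c.devU (r.sol k)) atTop (𝓝 0))
    (hT : Tendsto (fun k => c.traj (c.devX (r.sol k)) (c.devU (r.sol k)) (pbar + 1)) atTop (𝓝 0))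
    (hC : ∀ p ≤ pbar, ∀ j,
      Tendsto (fun k => c.Cp p ⬝ᵥ (c.A ^ j *ᵥ c.devX (r.sol k))) atTop (𝓝 0)) :
    Tendsto (fun k => c.trackingCost (c.devX (r.sol k)) (c.devU (r.sol k))) atTop (𝓝 0) := by
  unfold trackingCost
  rw [← add_zero (0 : ℝ)]
  refine Tendsto.add ?_ (tendsto_quad_zero _ hT)
  rw [← Finset.sum_const_zero (s := (Finset.univ : Finset (Fin (pbar + 1))))]
  refine tendsto_finsetSum _ fun p _ => ?_
  have h1 := hC p (by omega) 0
  simp only [pow_zero, one_mulVec] at h1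
  have h2 := h1.add (tendsto_dotProduct_zero (c.Dp p) hw)
  simpa using ((h2.pow 2).const_mul (c.Q p)).add (((tendsto_pi_nhds.1 hw p).pow 2).const_mul (c.R p))

/-- Needed at every stage of the horizon, since a moved reference must respect all predicted output
constraints. -/
lemma tendsto_output_traj (hw : Tendsto (fun k => c.devU (r.sol k)) atTop (𝓝 0))
    (hC : ∀ j, Tendsto (fun k => vecC o ⬝ᵥ (c.A ^ j *ᵥ c.devX (r.sol k))) atTop (𝓝 0))
    (j : ℕ) : Tendsto (fun k => vecC o ⬝ᵥ c.traj (c.devX (r.sol k)) (c.devU (r.sol k)) j)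
      atTop (𝓝 0) := by
  simp only [traj_eq_sum, dotProduct_add]
  rw [← add_zero (0 : ℝ)]
  refine (hC j).add (tendsto_dotProduct_zero _ ?_)
  rw [← Finset.sum_const_zero (s := Finset.range j)]
  refine tendsto_finsetSum _ fun i _ => ?_
  have : Tendsto (fun k => inputAt (c.devU (r.sol k)) i) atTop (𝓝 0) := by
    unfold inputAt
    split_ifs with hi
    · exact tendsto_pi_nhds.1 hw ⟨i, hi⟩
    · exact tendsto_const_nhds
  simpa using this.smul_const (c.A ^ (j - 1 - i) *ᵥ c.B₁)

/-- The references of the closed loop converge to the closest admissible set-point. -/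
lemma tendsto_zref (h : IsClosedLoop S c σ zgoal r) (hc : c.WellDesigned S Z)
    (hcv : c.ConvexSets) (hσ : 0 < σ) (hpos : 0 < o) (hfeas : ∀ k, c.Feasible (r.Xhat k))
    {zf : ℝ} (hzf : c.IsClosest zgoal zf)
    (hw : Tendsto (fun k => c.devU (r.sol k)) atTop (𝓝 0))
    (hT : Tendsto (fun k => c.traj (c.devX (r.sol k)) (c.devU (r.sol k)) (pbar + 1)) atTop (𝓝 0))
    (hC : ∀ p ≤ pbar, ∀ j,
      Tendsto (fun k => c.Cp p ⬝ᵥ (c.A ^ j *ᵥ c.devX (r.sol k))) atTop (𝓝 0)) :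
    Tendsto (fun k => (r.sol k).zref) atTop (𝓝 zf) := by
  have hwt := hc.weights
  obtain ⟨b, hb0, hb⟩ := exists_quad_le_mul_quad
    (vecMulVec (vecC o) (vecC o) + vecMulVec c.K c.K) c.P (PosDef.quad_pos hwt.P_pos)
  have hb' : ∀ y : State o, (vecC o ⬝ᵥ y) ^ 2 + (c.K ⬝ᵥ y) ^ 2 ≤ b * (y ⬝ᵥ (c.P *ᵥ y)) := by
    intro y
    refine le_trans (le_of_eq ?_) (hb y)
    simp only [add_mulVec, vecMulVec_mulVec, op_smul_eq_smul, dotProduct_comm y,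
      add_dotProduct, smul_dotProduct, smul_eq_mul]
    ring
  obtain ⟨m, hm⟩ := (isCompact_setPoints hpos hc.Xε_compact).isBounded.exists_norm_le
  have hr : ∀ k, (r.sol k).zref ∈ c.setPoints := fun k =>
    ((mem_terminalSet_iff hpos hwt).1 (h.optimal k (hfeas k)).1.terminal).2
  have hD : ∀ k, |zf - (r.sol k).zref| ≤ m + m := fun k =>
    (abs_sub _ _).trans (add_le_add (hm _ hzf.1) (hm _ (hr k)))
  have hε := hc.ε_pos
  have small : ∀ {f : ℝ → ℝ} {t : ℝ}, Continuous f → f 0 = 0 → 0 < t → ∀ᶠ β in 𝓝[>] 0, f β < t := by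
    intro f t hf h0 ht
    have h1 : Tendsto f (𝓝[>] 0) (𝓝 0) := by
      simpa [h0] using (hf.tendsto 0).mono_left nhdsWithin_le_nhds
    exact h1.eventually (gt_mem_nhds ht)
  set τ : ℝ := c.traj c.Nvec (fun _ : Fin (pbar + 1) => c.μ⁻¹) (pbar + 1)
      ⬝ᵥ (c.P *ᵥ c.traj c.Nvec (fun _ : Fin (pbar + 1) => c.μ⁻¹) (pbar + 1)) with hτ
  have hτ0 : 0 ≤ τ := hwt.P_nonneg _
  -- All references lie in the compact set of set-points, so `m + m` bounds every displacement and
  -- one `β` serves all times.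
  obtain ⟨β, hβ, hβ1, hβ2, hβ3, hβ4⟩ : ∃ β : ℝ, 0 < β ∧ β < 1 ∧
      2 * β * c.trackingCost c.Nvec (fun _ => c.μ⁻¹) < σ / 2 ∧
      b * (2 * ((β * (m + m)) ^ 2 * τ)) < c.ε ^ 2 / 2 ∧
      ∀ p : Fin (pbar + 1),
        β * (m + m) * (1 + |vecC o ⬝ᵥ c.traj c.Nvec (fun _ => c.μ⁻¹) p|) < c.ε / 2 := by
    refine Eventually.exists (f := 𝓝[>] (0 : ℝ)) ?_
    refine Eventually.and self_mem_nhdsWithin (Eventually.and ?_ (Eventually.and ?_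
      (Eventually.and ?_ (eventually_all.2 fun p => ?_))))
    · exact small continuous_id rfl one_pos
    · exact small (by fun_prop) (by simp) (half_pos hσ)
    · exact small (by fun_prop) (by simp) (half_pos (pow_pos hε 2))
    · exact small (by fun_prop) (by simp) (half_pos hε)
  have hC0 : ∀ j, Tendsto (fun k => vecC o ⬝ᵥ (c.A ^ j *ᵥ c.devX (r.sol k))) atTop (𝓝 0) := by
    simpa [Cp] using hC 0 (Nat.zero_le _)
  have ev1 : ∀ᶠ k in atTop, ∀ p : Fin (pbar + 1),
      |vecC o ⬝ᵥ c.traj (c.devX (r.sol k)) (c.devU (r.sol k)) p| ≤ c.ε / 2 := by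
    refine eventually_all.2 fun p => ?_
    have := (tendsto_output_traj hw hC0 p).abs
    rw [abs_zero] at this
    exact (this.eventually (gt_mem_nhds (half_pos hε))).mono fun _ => le_of_lt
  have ev2 : ∀ᶠ k in atTop, b * (2 * (c.traj (c.devX (r.sol k)) (c.devU (r.sol k)) (pbar + 1)
      ⬝ᵥ (c.P *ᵥ c.traj (c.devX (r.sol k)) (c.devU (r.sol k)) (pbar + 1)))) ≤ c.ε ^ 2 / 2 := by
    have h1 := ((tendsto_quad_zero c.P hT).const_mul 2).const_mul b
    rw [mul_zero, mul_zero] at h1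
    exact (h1.eventually (gt_mem_nhds (half_pos (pow_pos hε 2)))).mono fun _ => le_of_lt
  have key : Tendsto (fun k => (r.sol k).zref - zf) atTop (𝓝 0) := by
    refine tendsto_zero_of_mul_sq_le (q := σ * β / 2) (by positivity) ?_
      (tendsto_trackingCost hw hT hC)
    filter_upwards [ev1, ev2] with k hk1 hk2
    refine (h.optimal k (hfeas k)).sq_sub_le hpos hwt hcv hσ hzf (hr k) hβ hβ1.le hβ2.le ?_
    have hmove : |(r.sol k).zref + β * (zf - (r.sol k).zref) - (r.sol k).zref| ≤ β * (m + m) := by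
      rw [add_sub_cancel_left, abs_mul, abs_of_pos hβ]
      exact mul_le_mul_of_nonneg_left (hD k) hβ.le
    refine (h.optimal k (hfeas k)).1.move_ref hpos hc hb' hb0 ?_ (fun p => ?_) ?_ hk1 hk2
    · have := convex_setPoints hpos hcv (hr k) hzf.1 (sub_nonneg.2 hβ1.le) hβ.le (by ring)
      convert this using 1
      simp only [smul_eq_mul]
      ring
    · exact (mul_le_mul_of_nonneg_right hmove (by positivity)).trans (hβ4 p).le
    · refine le_trans ?_ hβ3.le
      have h1 := pow_le_pow_left₀ (abs_nonneg _) hmove 2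
      rw [sq_abs] at h1
      exact mul_le_mul_of_nonneg_left (mul_le_mul_of_nonneg_left
        (mul_le_mul_of_nonneg_right h1 hτ0) zero_le_two) hb0.le
  simpa using key.add_const zf

end IsClosedLoop

end LearnedMPC

theorem theorem2 (S : Plant) (o pbar : ℕ) (D : Learning o) (c : Controller o pbar) (Z : Set ℝ)
    (hS : S.Standing) (ho : S.n ≤ o) (hp : 1 ≤ pbar) (hZ : Convex ℝ Z)
    (hD : D.Standing S pbar)
    (hθ : D.IsNominal S pbar c.θ)
    (hτ : D.BoundsValid S pbar (c.θ 1))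
    (hw : IsLeast (D.disturbanceBounds S pbar (c.θ 1)) c.wbar)
    (hc : c.WellDesigned S Z) :
    (∀ σ : ℝ, 0 < σ → ∀ (zgoal : ℝ) (r : Signals o pbar), IsClosedLoop S c σ zgoal r →
      c.Feasible (r.Xhat 0) →
        ∀ k : ℕ, c.Feasible (r.Xhat k) ∧ r.u k ∈ S.U ∧ r.z k ∈ Z) ∧
    (c.ConvexSets →
      ∃ σ₀ : ℝ, ∀ σ : ℝ, σ₀ < σ → ∀ (zgoal : ℝ) (r : Signals o pbar),
        IsClosedLoop S c σ zgoal r → c.Feasible (r.Xhat 0) →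
          ∃ zf : ℝ, c.IsClosest zgoal zf ∧ (∀ x, c.IsClosest zgoal x → x = zf) ∧
            Filter.Tendsto (fun k : ℕ => vecC o ⬝ᵥ (r.sol k).X) Filter.atTop (nhds zf) ∧
            Filter.Tendsto
              (fun k : ℕ => Metric.infDist (r.z k)
                {x | ∃ e ∈ c.Ebar, ∃ e' ∈ c.Ehat, x = zf + vecC o ⬝ᵥ (e + e')})
              Filter.atTop (nhds 0)) := by
  have hpos : 0 < o := lt_of_lt_of_le hS.order_pos ho
  have hfeas : ∀ {σ zgoal : ℝ} {r : Signals o pbar}, IsClosedLoop S c σ zgoal r →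
      c.Feasible (r.Xhat 0) → ∀ k, c.Feasible (r.Xhat k) ∧ r.err k ∈ c.Ehat :=
    fun hr h0 => hr.feasible_and_err_mem hc hpos
      (fun z u v d ht k => abs_residual_le hpos hp hS.dbar_pos.le hD hτ hw.1 ht k) h0
  -- The threshold `σ₀ = 0` suffices, because the fraction `β` is adapted to `σ`.
  refine ⟨fun σ _ zgoal r hr h0 k => ?_, fun hcv => ⟨0, fun σ hσ zgoal r hr h0 => ?_⟩⟩
  · obtain ⟨h1, h2⟩ := hfeas hr h0 k
    exact ⟨h1, hr.input_mem hc h1, hr.output_mem hc hpos h1 h2⟩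
  · have hf := hfeas hr h0
    have hne : c.setPoints.Nonempty := ⟨(r.sol 0).zref,
      ((Controller.mem_terminalSet_iff hpos hc.weights).1 (hr.optimal 0 h0).1.terminal).2⟩
    obtain ⟨zf, hzf⟩ := Controller.exists_isClosest hpos hc.Xε_compact hne zgoal
    obtain ⟨hU, hT, hC⟩ := hr.tendsto_deviations hc hcv hσ hpos hf
    have href := hr.tendsto_zref hc hcv hσ hpos (fun k => (hf k).1) hzf hU hT hC
    have hout : Tendsto (fun k : ℕ => vecC o ⬝ᵥ (r.sol k).X) atTop (𝓝 zf) := by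
      have h1 := hC 0 (Nat.zero_le _) 0
      have h2 := h1.add href
      rw [zero_add] at h2
      refine h2.congr fun k => ?_
      simp [Controller.Cp, Controller.devX, c.vecC_Nvec hpos]
    refine ⟨zf, hzf, fun x hx => hzf.unique hpos hcv hx, hout, ?_⟩
    have hdist : Tendsto (fun k : ℕ => |vecC o ⬝ᵥ (r.sol k).X - zf|) atTop (𝓝 0) := by
      simpa using (hout.sub_const zf).abs
    refine squeeze_zero (fun k => Metric.infDist_nonneg) (fun k => ?_) hdist
    -- The true output is the nominal one plus `C` applied to the two errors; with `zf` in place of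
    -- the nominal output, the same errors give a point of the tube at distance `|C X̄ - zf|`.
    have hmem : zf + vecC o ⬝ᵥ (r.Xhat k - (r.sol k).X + r.err k)
        ∈ {x | ∃ e ∈ c.Ebar, ∃ e' ∈ c.Ehat, x = zf + vecC o ⬝ᵥ (e + e')} :=
      ⟨_, (hr.optimal k (hf k).1).1.initial, _, (hf k).2, rfl⟩
    refine (Metric.infDist_le_dist_of_mem hmem).trans (le_of_eq ?_)
    have hz : r.z k = vecC o ⬝ᵥ stateOf o r.z r.u k := by
      rw [vecC_dotProduct hpos]; simp [stateOf]
    rw [Real.dist_eq, hz]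
    congr 1
    simp only [Signals.err, dotProduct_add, dotProduct_sub]
    ring
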